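/- **Setting.** Write $\mathbb N=\{1,2,\dots\}$. For $t\in\mathbb R$ let $\mathcal D_t$ be the Hilbert space of holomorphic functions $f(z)=\sum_{n\ge1}a_nz^n$ on the open unit disc $\mathbb D$ with $\|f\|_t^2=\sum_{n\ge1}|a_n|^2(n+1)^t<\infty$; thus $\mathcal D_0=H^2_0(\mathbb D)$. Let $\rho$ be the Haar probability measure on $\mathbb T^\infty=\mathbb T\times\mathbb T\times\cdots$, and let $H^2(\mathbb T^\infty)$ be the closed linear span in $L^2(\mathbb T^\infty,\rho)$ of the monomials $\zeta^\alpha=\prod_j\zeta_j^{\alpha_j}$, $\alpha$ a finitely supported sequence of non-negative integers. Let $H^\infty(\mathbb T^\infty)$ be the algebra of essentially bounded functions in $H^2(\mathbb T^\infty)$; a function in $H^2(\mathbb T^\infty)$ is inner if it has modulus $1$ $\rho$-a.e. Let $p_1<p_2<\cdots$ be the primes and let $\alpha(n)$ be defined by $n=\prod_jp_j^{\alpha(n)_j}$. The Bohr transform is $\mathcal B:H_0^2(\mathbb D)\to H^2(\mathbb T^\infty)$, $\sum_{n\ge1} a_nz^n\mapsto\sum_{n\ge1} a_n\zeta^{\alpha(n)}$,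 and $\mathcal B_t:\mathcal D_t\to H^2(\mathbb T^\infty)$ is $\sum_{n\ge1} a_nz^n\mapsto\sum_{n\ge1} a_nn^{t/2}\zeta^{\alpha(n)}$. A sequence $(\lambda_k)_{k\in\mathbb N}$ of complex numbers is bounded above and below if $0<\inf_k|\lambda_k|\le\sup_k|\lambda_k|<\infty$. **Theorem.** Let $t\in\mathbb R$, let $f\in\mathcal D_t$ with $\|f\|_t=1$, and let $(\lambda_k)_{k\in\mathbb N}$ be a sequence of complex numbers. A *solution* is a bounded linear operator $T:\mathcal D_t\to\mathcal D_t$ such that $$T z^k=\lambda_k f(z^k),\qquad k=1,2,\dots$$ 1. If $t=0$, there is an isometric solution if and only if $\mathcal Bf$ is inner and $|\lambda_k|=1$ for all $k\in\mathbb N$. 2. If $t\ne0$, there is an isometric solution if and only if there are a positive integer $N$ and a constant $c\in\mathbb C$ such that $f=cz^N$, $|c|=(N+1)^{-t/2}$, and $$|\lambda_k|=\Big(\frac{kN+k+N+1}{kN+1}\Big)^{t/2}\quad\text{for every }k\in\mathbb N.$$ 3. There is a surjective solution if and only if $\mathcal B_tf$ is invertible in the algebra $H^\infty(\mathbb T^\infty)$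 and $(\lambda_k)$ is bounded above and below. Likewise, there is an invertible solution if and only if the same two conditions hold. 4. If $(\lambda_k)$ is bounded above and below, then there is a solution if and only if $\mathcal B_tf$ is bounded, that is, $\mathcal B_tf\in H^\infty(\mathbb T^\infty)$. -/

import Mathlib

open MeasureTheory Complex
open scoped Complex.UnitDisc ComplexConjugate ENNReal

noncomputable section

namespace PowerDilation

/-! ### Dirichlet-type spaces on the unit disc -/

/-- `a : ℕ+ → ℂ` is a weight-`t` square summable sequence of power series coefficients:
`∑_{n ≥ 1} |a n| ^ 2 (n + 1) ^ t < ∞`. -/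
def WeightedSummable (t : ℝ) (a : ℕ+ → ℂ) : Prop :=
  Summable fun n : ℕ+ => ‖a n‖ ^ 2 * ((n : ℝ) + 1) ^ t

/-- The function `g` on the unit disc is the sum of the power series `∑_{n ≥ 1} a n * z ^ n`
(in particular it is holomorphic and `g 0 = 0`). -/
def HasExpansion (g : 𝔻 → ℂ) (a : ℕ+ → ℂ) : Prop :=
  ∀ z : 𝔻, HasSum (fun n : ℕ+ => a n * (z : ℂ) ^ (n : ℕ)) (g z)

theorem weightedSummable_inner {t : ℝ} {a b : ℕ+ → ℂ}
    (ha : WeightedSummable t a) (hb : WeightedSummable t b) :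
    Summable fun n : ℕ+ => conj (a n) * b n * ((((n : ℝ) + 1) ^ t : ℝ) : ℂ) := by
  refine Summable.of_norm_bounded (ha.add hb) fun n => ?_
  have hw : 0 ≤ ((n : ℝ) + 1) ^ t := by positivity
  rw [norm_mul, norm_mul, RCLike.norm_conj, Complex.norm_real, Real.norm_of_nonneg hw, ← add_mul]
  refine mul_le_mul_of_nonneg_right ?_ hw
  nlinarith [sq_nonneg (‖a n‖ - ‖b n‖), sq_nonneg ‖a n‖, sq_nonneg ‖b n‖]

theorem WeightedSummable.add {t : ℝ} {a b : ℕ+ → ℂ}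
    (ha : WeightedSummable t a) (hb : WeightedSummable t b) : WeightedSummable t (a + b) := by
  refine Summable.of_nonneg_of_le (fun n => by positivity) (fun n => ?_)
    ((Summable.add (f := fun n : ℕ+ => ‖a n‖ ^ 2 * ((n : ℝ) + 1) ^ t) ha hb).mul_left 2)
  have hw : 0 ≤ ((n : ℝ) + 1) ^ t := by positivity
  have h1 : ‖a n + b n‖ ≤ ‖a n‖ + ‖b n‖ := norm_add_le _ _
  have h2 : ‖a n + b n‖ ^ 2 ≤ 2 * (‖a n‖ ^ 2 + ‖b n‖ ^ 2) := by
    nlinarith [sq_nonneg (‖a n‖ - ‖b n‖), norm_nonneg (a n + b n)]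
  calc ‖(a + b) n‖ ^ 2 * ((n : ℝ) + 1) ^ t
      ≤ 2 * (‖a n‖ ^ 2 + ‖b n‖ ^ 2) * ((n : ℝ) + 1) ^ t := mul_le_mul_of_nonneg_right h2 hw
    _ = _ := by ring

theorem WeightedSummable.smul {t : ℝ} {a : ℕ+ → ℂ} (c : ℂ)
    (ha : WeightedSummable t a) : WeightedSummable t (c • a) := by
  refine (Summable.mul_left (‖c‖ ^ 2) ha).congr fun n => ?_
  simp only [Pi.smul_apply, smul_eq_mul, norm_mul]
  ring

theorem HasExpansion.add {g h : 𝔻 → ℂ} {a b : ℕ+ → ℂ}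
    (hg : HasExpansion g a) (hh : HasExpansion h b) : HasExpansion (g + h) (a + b) := fun z => by
  simpa [add_mul] using (hg z).add (hh z)

theorem HasExpansion.smul {g : 𝔻 → ℂ} {a : ℕ+ → ℂ} (c : ℂ)
    (hg : HasExpansion g a) : HasExpansion (c • g) (c • a) := fun z => by
  simpa [mul_assoc] using (hg z).mul_left c

/-- The coefficients of a power series on the disc are unique. -/
theorem HasExpansion.unique {g : 𝔻 → ℂ} {a b : ℕ+ → ℂ}
    (ha : HasExpansion g a) (hb : HasExpansion g b) : a = b := by
  classical
  let ext : (ℕ+ → ℂ) → ℕ → ℂ := fun a n => if h : 0 < n then a ⟨n, h⟩ else 0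
  have hext : ∀ (a : ℕ+ → ℂ) (n : ℕ+), ext a n = a n := fun a n => by
    simp only [ext, n.pos, dite_true]
    rfl
  let G : ℂ → ℂ := fun w => if h : ‖w‖ < 1 then g (UnitDisc.mk w h) else 0
  have key : ∀ a : ℕ+ → ℂ, HasExpansion g a →
      HasFPowerSeriesOnBall G (FormalMultilinearSeries.ofScalars ℂ (ext a)) 0
        (((1 / 2 : NNReal)) : ℝ≥0∞) := by
    intro a ha
    have hs : ∀ w : ℂ, ‖w‖ < 1 → HasSum (fun n : ℕ => ext a n * w ^ n) (G w) := by
      intro w h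
      rw [← PNat.coe_injective.hasSum_iff]
      · have h2 := ha (UnitDisc.mk w h)
        have h3 : G w = g (UnitDisc.mk w h) := by simp [G, h]
        rw [h3]
        convert h2 using 2 with n
        rw [Function.comp_apply, hext, UnitDisc.coe_mk]
      · intro n hn
        have : ¬ 0 < n := fun h0 => hn ⟨⟨n, h0⟩, rfl⟩
        simp [ext, this]
    refine ⟨?_, by norm_num, ?_⟩
    · refine FormalMultilinearSeries.le_radius_of_summable _ ?_
      have h2 := (hs (1 / 2) (by norm_num)).summable.norm
      refine h2.congr fun n => ?_
      simp
    · intro y hy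
      have hy1 : ‖y‖ < 1 := by
        rw [Metric.mem_eball, edist_zero_right, enorm_eq_nnnorm, ENNReal.coe_lt_coe] at hy
        have : ‖y‖ < ((1 / 2 : NNReal) : ℝ) := hy
        norm_num at this
        linarith
      simpa [FormalMultilinearSeries.ofScalars_apply_eq, mul_comm] using hs y hy1
  have h1 := (key a ha).hasFPowerSeriesAt.eq_formalMultilinearSeries
    (key b hb).hasFPowerSeriesAt
  have h2 : ext a = ext b := FormalMultilinearSeries.ofScalars_series_injective ℂ ℂ h1
  funext n
  rw [← hext a n, ← hext b n, h2]

/-- Coefficient sequences of Dirichlet-type spaces define power series converging on the disc. -/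
theorem WeightedSummable.hasExpansion {t : ℝ} {a : ℕ+ → ℂ} (ha : WeightedSummable t a) :
    HasExpansion (fun z => ∑' n : ℕ+, a n * (z : ℂ) ^ (n : ℕ)) a := by
  intro z
  refine Summable.hasSum ?_
  obtain ⟨m, hm⟩ := exists_nat_ge (-t)
  have hz0 : 0 ≤ ‖(z : ℂ)‖ := norm_nonneg _
  have hz : ‖‖(z : ℂ)‖ ^ 2‖ < 1 := by
    rw [Real.norm_of_nonneg (by positivity)]
    exact z.sq_norm_lt_one
  have hgeo : Summable fun n : ℕ => (2 : ℝ) ^ m * ((n : ℝ) ^ m * (‖(z : ℂ)‖ ^ 2) ^ n) :=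
    (summable_pow_mul_geometric_of_norm_lt_one m hz).mul_left _
  have hgeo' := hgeo.comp_injective PNat.coe_injective
  refine Summable.of_norm_bounded
    (Summable.add (f := fun n : ℕ+ => ‖a n‖ ^ 2 * ((n : ℝ) + 1) ^ t) ha hgeo') fun n => ?_
  have hn : (1 : ℝ) ≤ (n : ℝ) := by exact_mod_cast n.pos
  have hpos : (0 : ℝ) < (n : ℝ) + 1 := by linarith
  set w : ℝ := ((n : ℝ) + 1) ^ t with hw
  have hw0 : 0 < w := by positivity
  have hwi : w⁻¹ ≤ 2 ^ m * (n : ℝ) ^ m := by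
    rw [hw, ← Real.rpow_neg hpos.le, ← mul_pow, ← Real.rpow_natCast]
    calc ((n : ℝ) + 1) ^ (-t) ≤ ((n : ℝ) + 1) ^ (m : ℝ) :=
          Real.rpow_le_rpow_of_exponent_le (by linarith) hm
      _ ≤ _ := Real.rpow_le_rpow hpos.le (by linarith) (by positivity)
  set r : ℝ := ‖(z : ℂ)‖ ^ (n : ℕ) with hr
  have hr0 : 0 ≤ r := by positivity
  have hrr : (‖(z : ℂ)‖ ^ 2) ^ (n : ℕ) = r ^ 2 := by rw [hr, ← pow_mul, ← pow_mul, mul_comm]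
  have h1 : ‖a n‖ * r ≤ ‖a n‖ ^ 2 * w + w⁻¹ * r ^ 2 := by
    have h3 : 0 ≤ w⁻¹ * (‖a n‖ * w - r) ^ 2 := by positivity
    have h4 : w⁻¹ * (‖a n‖ * w - r) ^ 2
        = ‖a n‖ ^ 2 * w - 2 * (‖a n‖ * r) + w⁻¹ * r ^ 2 := by
      field_simp
      ring
    have h5 : 0 ≤ ‖a n‖ * r := by positivity
    linarith
  have h2 : w⁻¹ * r ^ 2 ≤ 2 ^ m * (n : ℝ) ^ m * r ^ 2 :=
    mul_le_mul_of_nonneg_right hwi (by positivity)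
  calc ‖a n * (z : ℂ) ^ (n : ℕ)‖ = ‖a n‖ * r := by rw [norm_mul, norm_pow]
    _ ≤ ‖a n‖ ^ 2 * w + 2 ^ m * (n : ℝ) ^ m * r ^ 2 := h1.trans (by linarith)
    _ = _ := by simp only [Function.comp_apply, hrr]; ring

/-- The functions `g(z) = ∑_{n ≥ 1} a n * z ^ n` on the unit disc with
`∑_{n ≥ 1} |a n| ^ 2 (n + 1) ^ t < ∞`, as a linear subspace of all functions on the disc. -/
def dirichletSubmodule (t : ℝ) : Submodule ℂ (𝔻 → ℂ) where
  carrier := {g | ∃ a : ℕ+ → ℂ, WeightedSummable t a ∧ HasExpansion g a}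
  add_mem' := by
    rintro g h ⟨a, ha, hga⟩ ⟨b, hb, hhb⟩
    exact ⟨a + b, ha.add hb, hga.add hhb⟩
  zero_mem' := ⟨0, by simp [WeightedSummable, summable_zero], fun z => by simp [hasSum_zero]⟩
  smul_mem' := by
    rintro c g ⟨a, ha, hga⟩
    exact ⟨c • a, ha.smul c, hga.smul c⟩

/-- The Dirichlet-type space `D_t`. -/
def DirichletSpace (t : ℝ) : Type := dirichletSubmodule t

namespace DirichletSpace

variable {t : ℝ}

instance : AddCommGroup (DirichletSpace t) := inferInstanceAs (AddCommGroup (dirichletSubmodule t))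

instance : Module ℂ (DirichletSpace t) := inferInstanceAs (Module ℂ (dirichletSubmodule t))

instance : CoeFun (DirichletSpace t) (fun _ => 𝔻 → ℂ) := ⟨fun g => g.1⟩

/-- The power series coefficients of an element of `D_t`. -/
def coeff (g : DirichletSpace t) : ℕ+ → ℂ := g.2.choose

theorem weightedSummable_coeff (g : DirichletSpace t) : WeightedSummable t g.coeff :=
  g.2.choose_spec.1

theorem hasExpansion_coeff (g : DirichletSpace t) : HasExpansion g g.coeff :=
  g.2.choose_spec.2

theorem coeff_eq (g : DirichletSpace t) {a : ℕ+ → ℂ} (ha : HasExpansion g a) : g.coeff = a :=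
  g.hasExpansion_coeff.unique ha

theorem coeff_add (g h : DirichletSpace t) : (g + h).coeff = g.coeff + h.coeff :=
  coeff_eq _ (g.hasExpansion_coeff.add h.hasExpansion_coeff)

theorem coeff_smul (c : ℂ) (g : DirichletSpace t) : (c • g).coeff = c • g.coeff :=
  coeff_eq _ (g.hasExpansion_coeff.smul c)

theorem eq_zero_of_coeff (g : DirichletSpace t) (h : g.coeff = 0) : g = 0 := by
  refine Subtype.ext (funext fun z => ?_)
  have h1 := g.hasExpansion_coeff z
  rw [h] at h1
  simp only [Pi.zero_apply, zero_mul] at h1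
  exact h1.unique hasSum_zero

/-- The inner product `⟪g, h⟫ = ∑_{n ≥ 1} conj (a n) * b n * (n + 1) ^ t` on `D_t`. -/
@[reducible] def core (t : ℝ) : InnerProductSpace.Core ℂ (DirichletSpace t) where
  inner g h := ∑' n : ℕ+, conj (g.coeff n) * h.coeff n * ((((n : ℝ) + 1) ^ t : ℝ) : ℂ)
  conj_inner_symm g h := by
    rw [Complex.conj_tsum]
    refine tsum_congr fun n => ?_
    simp only [map_mul, Complex.conj_conj, Complex.conj_ofReal]
    ring
  re_inner_nonneg g := by
    rw [RCLike.re_eq_complex_re, Complex.re_tsum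
      (weightedSummable_inner g.weightedSummable_coeff g.weightedSummable_coeff)]
    refine tsum_nonneg fun n => ?_
    rw [Complex.re_mul_ofReal, ← Complex.normSq_eq_conj_mul_self, Complex.ofReal_re]
    exact mul_nonneg (Complex.normSq_nonneg _) (by positivity)
  add_left g h k := by
    rw [← (weightedSummable_inner g.weightedSummable_coeff k.weightedSummable_coeff).tsum_add
      (weightedSummable_inner h.weightedSummable_coeff k.weightedSummable_coeff)]
    refine tsum_congr fun n => ?_
    rw [coeff_add, Pi.add_apply, map_add]
    ring
  smul_left g h c := by
    rw [← tsum_mul_left]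
    refine tsum_congr fun n => ?_
    rw [coeff_smul, Pi.smul_apply, smul_eq_mul, map_mul]
    ring
  definite g hg := by
    have hs := weightedSummable_inner g.weightedSummable_coeff g.weightedSummable_coeff
    have h1 := congrArg Complex.re hg
    rw [Complex.re_tsum hs] at h1
    have hterm : ∀ n : ℕ+, (conj (g.coeff n) * g.coeff n * ((((n : ℝ) + 1) ^ t : ℝ) : ℂ)).re
        = ‖g.coeff n‖ ^ 2 * ((n : ℝ) + 1) ^ t := fun n => by
      rw [Complex.re_mul_ofReal, ← Complex.normSq_eq_conj_mul_self, Complex.ofReal_re,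
        Complex.normSq_eq_norm_sq]
    simp only [hterm, Complex.zero_re] at h1
    have h2 := (hasSum_zero_iff_of_nonneg (fun n => by positivity)).1
      (h1 ▸ g.weightedSummable_coeff.hasSum)
    refine eq_zero_of_coeff g (funext fun n => ?_)
    have h3 := congrFun h2 n
    have h4 : ((n : ℝ) + 1) ^ t ≠ 0 := by positivity
    simpa [h4] using h3

instance : NormedAddCommGroup (DirichletSpace t) := (core t).toNormedAddCommGroup

instance : InnerProductSpace ℂ (DirichletSpace t) := InnerProductSpace.ofCore (core t).toCore

/-- The norm of `D_t`: `‖g‖ ^ 2 = ∑_{n ≥ 1} |a n| ^ 2 (n + 1) ^ t`. -/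
theorem norm_sq_eq (g : DirichletSpace t) :
    ‖g‖ ^ 2 = ∑' n : ℕ+, ‖g.coeff n‖ ^ 2 * ((n : ℝ) + 1) ^ t := by
  rw [← inner_self_eq_norm_sq (𝕜 := ℂ)]
  change (∑' n : ℕ+, conj (g.coeff n) * g.coeff n * ((((n : ℝ) + 1) ^ t : ℝ) : ℂ)).re = _
  rw [Complex.re_tsum (weightedSummable_inner g.weightedSummable_coeff g.weightedSummable_coeff)]
  refine tsum_congr fun n => ?_
  rw [Complex.re_mul_ofReal, ← Complex.normSq_eq_conj_mul_self, Complex.ofReal_re,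
    Complex.normSq_eq_norm_sq]

/-- The element `∑_{n ≥ 1} a n * z ^ n` of `D_t` with given coefficients. -/
def ofCoeff (a : ℕ+ → ℂ) (ha : WeightedSummable t a) : DirichletSpace t :=
  ⟨fun z => ∑' n : ℕ+, a n * (z : ℂ) ^ (n : ℕ), a, ha, ha.hasExpansion⟩

/-- The monomial `z ^ k`, as an element of `D_t`. -/
def monomial (t : ℝ) (k : ℕ+) : DirichletSpace t :=
  ⟨fun z => (z : ℂ) ^ (k : ℕ), Pi.single k 1,
    summable_of_ne_finset_zero (s := {k}) fun n hn => by
      rw [Pi.single_eq_of_ne (by simpa using hn)]; simp,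
    fun z => by
      convert hasSum_single (f := fun n : ℕ+ => (Pi.single k 1 : ℕ+ → ℂ) n * (z : ℂ) ^ (n : ℕ)) k
        fun n hn => by rw [Pi.single_eq_of_ne hn, zero_mul] using 1
      simp⟩

/-- Multiplying the coefficients by `n ^ (t / 2)` maps `D_t` into `D_0`. -/
theorem weightedSummable_shift {a : ℕ+ → ℂ} (ha : WeightedSummable t a) :
    WeightedSummable 0 fun n : ℕ+ => a n * ((((n : ℝ) ^ (t / 2) : ℝ)) : ℂ) := by
  refine Summable.of_nonneg_of_le (fun n => by positivity) (fun n => ?_)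
    (Summable.mul_left (max 1 (2 ^ (-t) : ℝ)) ha)
  have hn : (1 : ℝ) ≤ (n : ℝ) := by exact_mod_cast n.pos
  have hn0 : (0 : ℝ) ≤ (n : ℝ) := by linarith
  have h1 : ((n : ℝ) ^ (t / 2)) ^ 2 = (n : ℝ) ^ t := by
    rw [← Real.rpow_natCast, ← Real.rpow_mul hn0]
    norm_num
  have h2 : (n : ℝ) ^ t ≤ max 1 (2 ^ (-t) : ℝ) * ((n : ℝ) + 1) ^ t := by
    have hw : 0 ≤ ((n : ℝ) + 1) ^ t := by positivity
    rcases le_total 0 t with ht | ht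
    · calc (n : ℝ) ^ t ≤ ((n : ℝ) + 1) ^ t := Real.rpow_le_rpow hn0 (by linarith) ht
        _ = 1 * ((n : ℝ) + 1) ^ t := (one_mul _).symm
        _ ≤ _ := mul_le_mul_of_nonneg_right (le_max_left _ _) hw
    · calc (n : ℝ) ^ t ≤ (((n : ℝ) + 1) / 2) ^ t :=
            Real.rpow_le_rpow_of_nonpos (by linarith) (by linarith) ht
        _ = 2 ^ (-t) * ((n : ℝ) + 1) ^ t := by
            rw [Real.div_rpow (by linarith) (by norm_num), Real.rpow_neg (by norm_num)]
            ring
        _ ≤ _ := mul_le_mul_of_nonneg_right (le_max_right _ _) hw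
  rw [norm_mul, mul_pow, Complex.norm_real, Real.norm_of_nonneg (by positivity), h1,
    Real.rpow_zero, mul_one]
  calc ‖a n‖ ^ 2 * (n : ℝ) ^ t
      ≤ ‖a n‖ ^ 2 * (max 1 (2 ^ (-t) : ℝ) * ((n : ℝ) + 1) ^ t) :=
        mul_le_mul_of_nonneg_left h2 (by positivity)
    _ = _ := by ring

/-- The map `S_t : D_t → D_0 = H_0^2(𝔻)`,
`∑_{n ≥ 1} a n * z ^ n ↦ ∑_{n ≥ 1} a n * n ^ (t / 2) * z ^ n`. -/
def shift (g : DirichletSpace t) : DirichletSpace 0 :=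
  ofCoeff (fun n : ℕ+ => g.coeff n * ((((n : ℝ) ^ (t / 2) : ℝ)) : ℂ))
    (weightedSummable_shift g.weightedSummable_coeff)

end DirichletSpace

/-! ### The Hardy space on the infinite torus -/

instance : MeasurableSpace Circle := borel Circle

instance : BorelSpace Circle := ⟨rfl⟩

/-- The infinite torus `𝕋^∞`. -/
abbrev InfTorus : Type := ℕ → Circle

/-- The Haar probability measure `ρ` on `𝕋^∞`. -/
def rho : Measure InfTorus := Measure.haarMeasure ⊤

instance : Measure.IsHaarMeasure rho := inferInstanceAs (Measure.IsHaarMeasure (Measure.haarMeasure _))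

instance : IsProbabilityMeasure rho := ⟨by
  simpa [rho] using Measure.haarMeasure_self (K₀ := (⊤ : TopologicalSpace.PositiveCompacts InfTorus))⟩

/-- The monomial `ζ ^ α = ∏_j ζ_j ^ α_j` on `𝕋^∞`, for a finitely supported `α`. -/
def torusMonomial (α : ℕ →₀ ℕ) : C(InfTorus, ℂ) where
  toFun ζ := α.prod fun j e => (ζ j : ℂ) ^ e
  continuous_toFun := by
    unfold Finsupp.prod
    fun_prop

/-- `ζ ^ α` as an element of `L^2(𝕋^∞, ρ)`. -/
def torusMonomialL2 (α : ℕ →₀ ℕ) : Lp ℂ 2 rho := ContinuousMap.toLp 2 rho ℂ (torusMonomial α)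

/-- `H^2(𝕋^∞)`: the closed linear span of the monomials `ζ ^ α` in `L^2(𝕋^∞, ρ)`. -/
def hardySpace : Submodule ℂ (Lp ℂ 2 rho) :=
  (Submodule.span ℂ (Set.range torusMonomialL2)).topologicalClosure

/-- The exponent vector `α(n)` of the prime factorization `n = ∏_j p_j ^ α(n)_j`, where
`p_0 < p_1 < ⋯` are the primes. -/
def primeExponents (n : ℕ+) : ℕ →₀ ℕ :=
  (n : ℕ).factorization.comapDomain (Nat.nth Nat.Prime)
    (Nat.nth_injective Nat.infinite_setOfPred_prime).injOn

theorem primeExponents_injective : Function.Injective primeExponents := by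
  intro m n h
  refine PNat.coe_injective (Nat.eq_of_factorization_eq m.ne_zero n.ne_zero fun p => ?_)
  by_cases hp : p.Prime
  · have h1 := DFunLike.congr_fun h (Nat.count Nat.Prime p)
    simpa [primeExponents, Nat.nth_count hp] using h1
  · simp [Nat.factorization_eq_zero_of_not_prime, hp]

theorem norm_torusMonomial (α : ℕ →₀ ℕ) (ζ : InfTorus) : ‖torusMonomial α ζ‖ = 1 := by
  simp [torusMonomial, Finsupp.prod, norm_prod, Circle.norm_coe]

theorem torusMonomial_mul (α : ℕ →₀ ℕ) (ζ ξ : InfTorus) :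
    torusMonomial α (ζ * ξ) = torusMonomial α ζ * torusMonomial α ξ := by
  simp [torusMonomial, Finsupp.prod, mul_pow, Finset.prod_mul_distrib]

theorem torusMonomial_mulSingle (α : ℕ →₀ ℕ) (j : ℕ) (c : Circle) :
    torusMonomial α (Pi.mulSingle j c) = (c : ℂ) ^ α j := by
  classical
  change α.prod (fun i e => ((Pi.mulSingle j c : InfTorus) i : ℂ) ^ e) = _
  rw [Finsupp.prod, Finset.prod_eq_single j]
  · simp
  · intro i _ hi
    simp [Pi.mulSingle_eq_of_ne hi]
  · intro hj
    simp [Finsupp.notMem_support_iff.1 hj]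

/-- The monomials are orthonormal in `L^2(𝕋^∞, ρ)`. -/
theorem orthonormal_torusMonomialL2 : Orthonormal ℂ torusMonomialL2 := by
  classical
  rw [orthonormal_iff_ite]
  intro α β
  rw [torusMonomialL2, torusMonomialL2, ContinuousMap.inner_toLp]
  split_ifs with h
  · subst h
    have h1 : ∀ ζ, torusMonomial α ζ * conj (torusMonomial α ζ) = 1 := fun ζ => by
      rw [Complex.mul_conj, Complex.normSq_eq_norm_sq, norm_torusMonomial]
      simp
    simp [h1]
  · obtain ⟨j, hj⟩ : ∃ j, α j ≠ β j := by
      by_contra! hc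
      exact h (Finsupp.ext hc)
    let c : Circle := Circle.exp 1
    let F : InfTorus → ℂ := fun ζ => torusMonomial β ζ * conj (torusMonomial α ζ)
    let u : ℂ := (c : ℂ) ^ β j * conj ((c : ℂ) ^ α j)
    have hu : u ≠ 1 := by
      intro hu
      have h2 : (c : ℂ) ^ β j = (c : ℂ) ^ α j := by
        have h3 : (c : ℂ) ^ α j * conj ((c : ℂ) ^ α j) = 1 := by
          rw [Complex.mul_conj, Complex.normSq_eq_norm_sq]
          simp [Circle.norm_coe]
        have h4 : conj ((c : ℂ) ^ α j) ≠ 0 := fun h0 => by simp [h0] at h3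
        exact mul_right_cancel₀ h4 (hu.trans h3.symm)
      simp only [c, Circle.coe_exp, ← Complex.exp_nat_mul] at h2
      obtain ⟨n, hn⟩ := Complex.exp_eq_exp_iff_exists_int.1 h2
      have h6 : (β j : ℝ) = α j + n * (2 * Real.pi) := by
        have := congrArg Complex.im hn
        simpa using this
      have hn0 : n ≠ 0 := by
        rintro rfl
        exact hj (by exact_mod_cast (by simpa using h6.symm : (α j : ℝ) = β j))
      have hn1 : (n : ℝ) ≠ 0 := by exact_mod_cast hn0
      refine irrational_pi ⟨((β j : ℚ) - α j) / (2 * n), ?_⟩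
      push_cast
      rw [div_eq_iff (by positivity), h6]
      ring
    have h1 : ∫ ζ, F ζ ∂rho = u * ∫ ζ, F ζ ∂rho := by
      rw [← integral_const_mul, ← integral_mul_left_eq_self F (Pi.mulSingle j c : InfTorus)]
      refine integral_congr_ae (Filter.Eventually.of_forall fun ζ => ?_)
      simp only [F, u, torusMonomial_mul, torusMonomial_mulSingle, map_mul]
      ring
    have h5 : (u - 1) * ∫ ζ, F ζ ∂rho = 0 := by
      rw [sub_mul, one_mul, ← h1, sub_self]
    exact (mul_eq_zero.1 h5).resolve_left (sub_ne_zero.2 hu)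

/-- The series defining the Bohr transform converges in `L^2(𝕋^∞, ρ)`. -/
theorem summable_bohr (g : DirichletSpace 0) :
    Summable fun n : ℕ+ => g.coeff n • torusMonomialL2 (primeExponents n) := by
  have h := orthonormal_torusMonomialL2.comp _ primeExponents_injective
  refine (h.orthogonalFamily.summable_iff_norm_sq_summable g.coeff).2 ?_
  simpa [WeightedSummable] using g.weightedSummable_coeff

/-- The Bohr transform `ℬ : H_0^2(𝔻) = D_0 → H^2(𝕋^∞)`,
`∑_{n ≥ 1} a n * z ^ n ↦ ∑_{n ≥ 1} a n * ζ ^ α(n)`. -/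
def bohr (g : DirichletSpace 0) : hardySpace :=
  ⟨∑' n : ℕ+, g.coeff n • torusMonomialL2 (primeExponents n),
    (Submodule.isClosed_topologicalClosure _).mem_of_tendsto (summable_bohr g).hasSum
      (Filter.Eventually.of_forall fun _ => Submodule.sum_mem _ fun _ _ =>
        Submodule.smul_mem _ _ (Submodule.le_topologicalClosure _
          (Submodule.subset_span ⟨_, rfl⟩)))⟩

/-- The transform `ℬ_t = ℬ ∘ S_t : D_t → H^2(𝕋^∞)`. -/
def bohrT {t : ℝ} (g : DirichletSpace t) : hardySpace := bohr g.shift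

/-- `F ∈ H^2(𝕋^∞)` is inner: it has modulus one almost everywhere. -/
def IsInner (F : hardySpace) : Prop := ∀ᵐ ζ ∂rho, ‖(F : Lp ℂ 2 rho) ζ‖ = 1

/-- `F ∈ H^2(𝕋^∞)` is (essentially) bounded, that is, `F ∈ H^∞(𝕋^∞)`. -/
def IsBdd (F : hardySpace) : Prop := ∃ C : ℝ, ∀ᵐ ζ ∂rho, ‖(F : Lp ℂ 2 rho) ζ‖ ≤ C

/-- `F` belongs to the algebra `H^∞(𝕋^∞)` and has an inverse in that algebra. -/
def IsInvertibleHInf (F : hardySpace) : Prop :=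
  IsBdd F ∧ ∃ G : hardySpace, IsBdd G ∧
    ∀ᵐ ζ ∂rho, (F : Lp ℂ 2 rho) ζ * (G : Lp ℂ 2 rho) ζ = 1

/-! ### The operator moment problem -/

/-- The bounded operator `T` on `D_t` satisfies `T z ^ k = lam k * f(z ^ k)` for all `k ≥ 1`. -/
def SolvesMoment {t : ℝ} (f : DirichletSpace t) (lam : ℕ+ → ℂ)
    (T : DirichletSpace t →L[ℂ] DirichletSpace t) : Prop :=
  ∀ (k : ℕ+) (z : 𝔻), T (DirichletSpace.monomial t k) z = lam k * f (z ^ k)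

/-- The sequence is bounded from above and below: `0 < inf |lam k| ≤ sup |lam k| < ∞`. -/
def BddAboveBelow (lam : ℕ+ → ℂ) : Prop :=
  ∃ m M : ℝ, 0 < m ∧ ∀ k : ℕ+, m ≤ ‖lam k‖ ∧ ‖lam k‖ ≤ M

end PowerDilation

end

noncomputable section

namespace PowerDilation

open Filter Topology

/-! ### Characters of the infinite torus indexed by the positive integers -/

/-! Write `E_n = ζ ^ α(n)`. Unique factorization makes `n ↦ E_n` multiplicative, and the `E_n` form
an orthonormal basis of `H^2`. The transform `ℬ_t` is an isomorphism of `D_t` onto `H^2`, isometric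
for `t = 0`, sending `z ^ k` to `k ^ (t / 2) E_k` and `f(z ^ k)` to `k ^ (t / 2) E_k F`, where `F =
ℬ_t f`. The moment problem thus becomes `S E_k = λ_k E_k F`: formally, `S` is the diagonal operator
`λ` followed by multiplication by `F`.

Bounded solutions. If `λ` is bounded above and below, the diagonal part is invertible, so `S` is
bounded exactly when `F` multiplies `H^2` into itself boundedly. Such an `F` is bounded
(`ae_norm_le_of_multiplier`): every trigonometric polynomial becomes analytic on multiplication by a
unimodular `E_k`, so the estimate passes from `H^2` to all of `L^2`.

Surjective solutions. In the basis `E_n` the operator is triangular for divisibility. Solving `S g =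
E_n` by forward substitution, with the norm control of the open mapping theorem, bounds `λ` from
below (`bddAboveBelow_of_surjective`). Then multiplication by `F` is onto, and the inverse operator
is multiplication by `1 / F`. Conversely the two conditions give an invertible solution.

Isometric solutions. For `t = 0`, `|F| ^ 2` is orthogonal to every nontrivial character, hence
constant (`conj_mul_eq_const`). For `t ≠ 0`, the functions `f(z ^ (d * j))` and `f(z ^ (d * k))` are
orthogonal in `D_t` for all `d` whenever `j ≠ k`. Expanding the weight `(d n + 1) ^ t = (d n) ^ t (1
+ t / (d n) + ⋯)` as `d → ∞` yields two relations in `H^2`, which say that `conj F * F` and `conj F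
* F₁` are constant, `F₁` being the transform of `∑ (a n / n) z ^ n`. So `F₁` is proportional to `F`,
and only one coefficient of `f` can be nonzero. -/

theorem primeExponents_one : primeExponents 1 = 0 := by
  ext j
  simp [primeExponents]

theorem primeExponents_mul (m n : ℕ+) :
    primeExponents (m * n) = primeExponents m + primeExponents n := by
  ext j
  simp [primeExponents, Nat.factorization_mul m.ne_zero n.ne_zero]

theorem torusMonomial_zero : torusMonomial 0 = 1 := by
  ext ζ
  simp [torusMonomial]

theorem torusMonomial_add (α β : ℕ →₀ ℕ) :
    torusMonomial (α + β) = torusMonomial α * torusMonomial β := by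
  ext ζ
  exact Finsupp.prod_add_index' (fun _ => pow_zero _) fun _ _ _ => pow_add _ _ _

/-- The `j`-th prime, as a positive integer. -/
def nthPrime (j : ℕ) : ℕ+ := ⟨Nat.nth Nat.Prime j, (Nat.prime_nth_prime j).pos⟩

theorem primeExponents_nthPrime (j : ℕ) :
    primeExponents (nthPrime j) = Finsupp.single j 1 := by
  ext i
  change (Nat.nth Nat.Prime j).factorization (Nat.nth Nat.Prime i) = _
  rw [(Nat.prime_nth_prime j).factorization, Finsupp.single_apply, Finsupp.single_apply]
  simp [(Nat.nth_injective Nat.infinite_setOfPred_prime).eq_iff]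

/-- Allows the positive integers to index all monomials of `H^2`, so that the `E_n` span it. -/
theorem primeExponents_surjective : Function.Surjective primeExponents := by
  intro α
  induction α using Finsupp.induction_linear with
  | zero => exact ⟨1, primeExponents_one⟩
  | add f g hf hg =>
    obtain ⟨m, rfl⟩ := hf
    obtain ⟨n, rfl⟩ := hg
    exact ⟨m * n, primeExponents_mul m n⟩
  | single j e =>
    induction e with
    | zero => exact ⟨1, by simp [primeExponents_one]⟩
    | succ e ih =>
      obtain ⟨m, hm⟩ := ih
      exact ⟨m * nthPrime j, by
        rw [primeExponents_mul, hm, primeExponents_nthPrime, Finsupp.single_add]⟩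

/-- The function `ζ ↦ ζ ^ α(n)` on the infinite torus, multiplicative in `n`. -/
def bohrChar : ℕ+ →* C(InfTorus, ℂ) where
  toFun n := torusMonomial (primeExponents n)
  map_one' := by rw [primeExponents_one, torusMonomial_zero]
  map_mul' m n := by rw [primeExponents_mul, torusMonomial_add]

theorem norm_bohrChar (n : ℕ+) (ζ : InfTorus) : ‖bohrChar n ζ‖ = 1 := norm_torusMonomial _ _

theorem bohrChar_mul_star (n : ℕ+) : bohrChar n * star (bohrChar n) = 1 := by
  ext ζ
  have h := norm_bohrChar n ζ
  simp [Complex.mul_conj, Complex.normSq_eq_norm_sq, h]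

theorem bohrChar_nthPrime_apply (j : ℕ) (ζ : InfTorus) :
    bohrChar (nthPrime j) ζ = ζ j := by
  change torusMonomial (primeExponents _) ζ = _
  rw [primeExponents_nthPrime]
  simp [torusMonomial]

/-- The characters `E_j * conj E_k` of the torus, as a submonoid of the continuous functions. -/
def trigMonoid : Submonoid C(InfTorus, ℂ) where
  carrier := {q | ∃ j k : ℕ+, q = bohrChar j * star (bohrChar k)}
  one_mem' := ⟨1, 1, by simp⟩
  mul_mem' := by
    rintro _ _ ⟨j, k, rfl⟩ ⟨l, m, rfl⟩
    exact ⟨j * l, k * m, by rw [map_mul, map_mul, star_mul']; ring⟩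

/-- The trigonometric polynomials on the infinite torus. -/
def trigPoly : StarSubalgebra ℂ C(InfTorus, ℂ) where
  toSubalgebra := Algebra.adjoin ℂ (trigMonoid : Set C(InfTorus, ℂ))
  star_mem' := by
    intro a ha
    induction ha using Algebra.adjoin_induction with
    | mem x hx =>
      obtain ⟨j, k, rfl⟩ := hx
      exact Algebra.subset_adjoin ⟨k, j, by rw [star_mul', star_star, mul_comm]⟩
    | algebraMap r =>
      rw [← algebraMap_star_comm]
      exact Subalgebra.algebraMap_mem _ _
    | add x y _ _ hx hy => rw [star_add]; exact Subalgebra.add_mem _ hx hy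
    | mul x y _ _ hx hy => rw [star_mul']; exact Subalgebra.mul_mem _ hx hy

/-- The characters are closed under products, so the algebra they generate is already their linear
span. -/
theorem trigPoly_toSubmodule :
    Subalgebra.toSubmodule trigPoly.toSubalgebra
      = Submodule.span ℂ (trigMonoid : Set C(InfTorus, ℂ)) := by
  change Subalgebra.toSubmodule (Algebra.adjoin ℂ _) = _
  rw [Algebra.adjoin_eq_span, Submonoid.closure_eq]

/-- Stone–Weierstrass: the coordinate functions, which are the `E_p` with `p` prime, separate
points. -/
theorem trigPoly_topologicalClosure : trigPoly.topologicalClosure = ⊤ := by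
  refine ContinuousMap.starSubalgebra_topologicalClosure_eq_top_of_separatesPoints _ ?_
  intro ζ ξ h
  obtain ⟨j, hj⟩ := Function.ne_iff.1 h
  refine ⟨_, ⟨bohrChar (nthPrime j),
    Algebra.subset_adjoin ⟨nthPrime j, 1, ?_⟩, rfl⟩, ?_⟩
  · rw [map_one, star_one, mul_one]
  · simpa [bohrChar_nthPrime_apply, Circle.coe_inj] using hj

/-- `E_n = ζ ^ α(n)` as an element of `L^2`. -/
abbrev charL2 (n : ℕ+) : Lp ℂ 2 rho := torusMonomialL2 (primeExponents n)

theorem coeFn_charL2 (n : ℕ+) : charL2 n =ᵐ[rho] bohrChar n := ContinuousMap.coeFn_toLp _ _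

theorem orthonormal_charL2 : Orthonormal ℂ charL2 :=
  orthonormal_torusMonomialL2.comp _ primeExponents_injective

theorem hardySpace_eq :
    hardySpace = (Submodule.span ℂ (Set.range charL2)).topologicalClosure := by
  have : Set.range torusMonomialL2 = Set.range charL2 := by
    rw [show charL2 = torusMonomialL2 ∘ primeExponents from rfl,
      primeExponents_surjective.range_comp]
  rw [hardySpace, this]

/-- Trigonometric polynomials are dense in `L^2`. -/
theorem span_trig_dense :
    (Submodule.span ℂ (ContinuousMap.toLp 2 rho ℂ '' (trigMonoid : Set C(InfTorus, ℂ)))).topologicalClosure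
      = ⊤ := by
  have h1 : (Submodule.span ℂ (trigMonoid : Set C(InfTorus, ℂ))).topologicalClosure = ⊤ := by
    rw [← trigPoly_toSubmodule]
    exact congrArg (fun A : StarSubalgebra ℂ C(InfTorus, ℂ) =>
      Subalgebra.toSubmodule A.toSubalgebra) trigPoly_topologicalClosure
  have h2 := (ContinuousMap.toLp_denseRange ℂ rho ℂ
    (p := 2) (by simp)).topologicalClosure_map_submodule h1
  rw [Submodule.map_span] at h2
  exact h2

/-- Every trigonometric polynomial is a unimodular multiple of an analytic polynomial. -/
theorem exists_bohrChar_mul_mem {q : C(InfTorus, ℂ)}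
    (hq : q ∈ Submodule.span ℂ (trigMonoid : Set C(InfTorus, ℂ))) :
    ∃ k : ℕ+, bohrChar k * q ∈ Submodule.span ℂ (Set.range bohrChar) := by
  have hmul : ∀ (k : ℕ+) (p : C(InfTorus, ℂ)), p ∈ Submodule.span ℂ (Set.range bohrChar) →
      bohrChar k * p ∈ Submodule.span ℂ (Set.range bohrChar) := by
    intro k p hp
    induction hp using Submodule.span_induction with
    | mem x hx =>
      obtain ⟨j, rfl⟩ := hx
      rw [← map_mul]
      exact Submodule.subset_span ⟨_, rfl⟩
    | zero => simp
    | add x y _ _ hx hy => rw [mul_add]; exact Submodule.add_mem _ hx hy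
    | smul a x _ hx => rw [mul_smul_comm]; exact Submodule.smul_mem _ _ hx
  induction hq using Submodule.span_induction with
  | mem x hx =>
    obtain ⟨j, k, rfl⟩ := hx
    -- Multiplication by `E_k` clears the factor `conj E_k`.
    refine ⟨k, ?_⟩
    rw [mul_left_comm, bohrChar_mul_star, mul_one]
    exact Submodule.subset_span ⟨_, rfl⟩
  | zero => exact ⟨1, by simp⟩
  | add x y _ _ hx hy =>
    obtain ⟨j, hj⟩ := hx
    obtain ⟨k, hk⟩ := hy
    refine ⟨j * k, ?_⟩
    rw [mul_add, map_mul]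
    refine Submodule.add_mem _ ?_ ?_
    · rw [mul_comm (bohrChar j), mul_assoc]
      exact hmul _ _ hj
    · rw [mul_assoc]
      exact hmul _ _ hk
  | smul a x _ hx =>
    obtain ⟨j, hj⟩ := hx
    exact ⟨j, by rw [mul_smul_comm]; exact Submodule.smul_mem _ _ hj⟩

/-! ### Multiplication operators -/

/-- Multiplication by an essentially bounded function on `L^2`. -/
def mulLp (φ : Lp ℂ ∞ rho) : Lp ℂ 2 rho →L[ℂ] Lp ℂ 2 rho :=
  (ContinuousLinearMap.mul ℂ ℂ).holderL rho ∞ 2 2 φ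

theorem coeFn_mulLp (φ : Lp ℂ ∞ rho) (g : Lp ℂ 2 rho) :
    mulLp φ g =ᵐ[rho] fun ζ => φ ζ * g ζ :=
  (ContinuousLinearMap.mul ℂ ℂ).coeFn_holder φ g

/-- Multiplication by `E_k` on `L^2`. -/
def mulChar (k : ℕ+) : Lp ℂ 2 rho →L[ℂ] Lp ℂ 2 rho :=
  mulLp (ContinuousMap.toLp ∞ rho ℂ (bohrChar k))

theorem coeFn_mulChar (k : ℕ+) (g : Lp ℂ 2 rho) :
    mulChar k g =ᵐ[rho] fun ζ => bohrChar k ζ * g ζ := by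
  filter_upwards [coeFn_mulLp (ContinuousMap.toLp ∞ rho ℂ (bohrChar k)) g,
    ContinuousMap.coeFn_toLp (p := ∞) (𝕜 := ℂ) rho (bohrChar k)] with ζ h1 h2
  rw [mulChar, h1, h2]

theorem mulChar_charL2 (k n : ℕ+) : mulChar k (charL2 n) = charL2 (k * n) := by
  refine Lp.ext ?_
  filter_upwards [coeFn_mulChar k (charL2 n), coeFn_charL2 n, coeFn_charL2 (k * n)]
    with ζ h1 h2 h3
  rw [h1, h2, h3, map_mul, ContinuousMap.mul_apply]

theorem norm_mulChar (k : ℕ+) (g : Lp ℂ 2 rho) : ‖mulChar k g‖ = ‖g‖ := by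
  rw [Lp.norm_def, Lp.norm_def]
  congr 1
  refine eLpNorm_congr_norm_ae ?_
  filter_upwards [coeFn_mulChar k g] with ζ h
  rw [h, norm_mul, norm_bohrChar, one_mul]

/-- `H^2` is the closed span of the `E_n`, so invariance need only be tested on them. -/
theorem map_mem_hardySpace {A : Lp ℂ 2 rho →L[ℂ] Lp ℂ 2 rho}
    (hA : ∀ n, A (charL2 n) ∈ hardySpace) {g : Lp ℂ 2 rho} (hg : g ∈ hardySpace) :
    A g ∈ hardySpace := by
  have hclosed : IsClosed (hardySpace : Set (Lp ℂ 2 rho)) :=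
    Submodule.isClosed_topologicalClosure _
  have h : hardySpace ≤ hardySpace.comap (A : Lp ℂ 2 rho →ₗ[ℂ] Lp ℂ 2 rho) := by
    conv_lhs => rw [hardySpace_eq]
    refine Submodule.topologicalClosure_minimal _ ?_ (hclosed.preimage A.continuous)
    rw [Submodule.span_le]
    rintro _ ⟨n, rfl⟩
    exact hA n
  exact h hg

theorem charL2_mem (n : ℕ+) : charL2 n ∈ hardySpace :=
  Submodule.le_topologicalClosure _ (Submodule.subset_span ⟨_, rfl⟩)

theorem mulChar_mem (k : ℕ+) {g : Lp ℂ 2 rho} (hg : g ∈ hardySpace) :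
    mulChar k g ∈ hardySpace :=
  map_mem_hardySpace (fun n => by rw [mulChar_charL2]; exact charL2_mem _) hg

/-- A bounded function of `H^2` as an element of `L^∞`. -/
def IsBdd.toLinf {F : hardySpace} (hF : IsBdd F) : Lp ℂ ∞ rho :=
  (memLp_top_of_bound (Lp.aestronglyMeasurable (F : Lp ℂ 2 rho)) hF.choose hF.choose_spec).toLp _

theorem IsBdd.coeFn_toLinf {F : hardySpace} (hF : IsBdd F) :
    hF.toLinf =ᵐ[rho] (F : Lp ℂ 2 rho) := MemLp.coeFn_toLp _

theorem IsBdd.coeFn_mulLp {F : hardySpace} (hF : IsBdd F) (g : Lp ℂ 2 rho) :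
    mulLp hF.toLinf g =ᵐ[rho] fun ζ => (F : Lp ℂ 2 rho) ζ * g ζ := by
  filter_upwards [PowerDilation.coeFn_mulLp hF.toLinf g, hF.coeFn_toLinf] with ζ h1 h2
  rw [h1, h2]

theorem IsBdd.mulLp_charL2 {F : hardySpace} (hF : IsBdd F) (k : ℕ+) :
    mulLp hF.toLinf (charL2 k) = mulChar k F := by
  refine Lp.ext ?_
  filter_upwards [hF.coeFn_mulLp (charL2 k), coeFn_mulChar k F, coeFn_charL2 k] with ζ h1 h2 h3
  rw [h1, h2, h3, mul_comm]

/-- Multiplication by a function of `H^∞` on `H^2`. -/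
def IsBdd.mulHardy {F : hardySpace} (hF : IsBdd F) : hardySpace →L[ℂ] hardySpace :=
  ((mulLp hF.toLinf).comp hardySpace.subtypeL).codRestrict hardySpace fun g =>
    map_mem_hardySpace (fun k => by
      rw [hF.mulLp_charL2]
      exact mulChar_mem k F.2) g.2

theorem IsBdd.coeFn_mulHardy {F : hardySpace} (hF : IsBdd F) (g : hardySpace) :
    (hF.mulHardy g : Lp ℂ 2 rho) =ᵐ[rho] fun ζ => (F : Lp ℂ 2 rho) ζ * (g : Lp ℂ 2 rho) ζ :=
  hF.coeFn_mulLp g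

/-- A function whose products with trigonometric polynomials satisfy `‖F q‖ ≤ C ‖q‖` in `L^2`
is bounded by `C`. -/
theorem ae_norm_le_of_trig {F : Lp ℂ 2 rho} {C : ℝ} (hC : 0 ≤ C)
    (h : ∀ q ∈ Submodule.span ℂ (trigMonoid : Set C(InfTorus, ℂ)),
      eLpNorm (fun ζ => F ζ * q ζ) 2 rho ≤ ENNReal.ofReal C * eLpNorm q 2 rho) :
    ∀ᵐ ζ ∂rho, ‖F ζ‖ ≤ C := by
  -- The bound extends to all of `L^2`: approximate `g` by trigonometric polynomials, pass to an
  -- almost everywhere convergent subsequence and apply Fatou's lemma.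
  have hL2 : ∀ g : Lp ℂ 2 rho,
      eLpNorm (fun ζ => F ζ * g ζ) 2 rho ≤ ENNReal.ofReal C * eLpNorm g 2 rho := by
    intro g
    have hg : g ∈ closure ((Submodule.span ℂ
        (ContinuousMap.toLp 2 rho ℂ '' (trigMonoid : Set C(InfTorus, ℂ))) :
          Submodule ℂ (Lp ℂ 2 rho)) : Set (Lp ℂ 2 rho)) := by
      rw [← Submodule.topologicalClosure_coe, span_trig_dense]
      trivial
    obtain ⟨u, hu, hlim⟩ := mem_closure_iff_seq_limit.1 hg
    have hu' : ∀ n, eLpNorm (fun ζ => F ζ * u n ζ) 2 rho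
        ≤ ENNReal.ofReal C * eLpNorm (u n) 2 rho := by
      intro n
      have h1 := hu n
      rw [← ContinuousLinearMap.coe_coe, ← Submodule.map_span] at h1
      obtain ⟨q, hq, hqu⟩ := h1
      have h2 : u n =ᵐ[rho] q := by
        rw [← hqu]
        exact ContinuousMap.coeFn_toLp _ _
      rw [eLpNorm_congr_ae h2, eLpNorm_congr_ae (g := fun ζ => F ζ * q ζ)
        (h2.mono fun ζ hζ => by simp only [hζ])]
      exact h q hq
    obtain ⟨ns, hns, hae⟩ := (tendstoInMeasure_of_tendsto_Lp hlim).exists_seq_tendsto_ae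
    have h3 := Lp.eLpNorm_lim_le_liminf_eLpNorm (p := 2) (μ := rho)
      (f := fun i ζ => F ζ * u (ns i) ζ)
      (fun i => (Lp.aestronglyMeasurable F).mul (Lp.aestronglyMeasurable _))
      (fun ζ => F ζ * g ζ) (hae.mono fun ζ hζ => hζ.const_mul _)
    refine h3.trans ?_
    have h4 : Tendsto (fun i => ENNReal.ofReal C * eLpNorm (u (ns i)) 2 rho) atTop
        (𝓝 (ENNReal.ofReal C * eLpNorm g 2 rho)) := by
      refine ENNReal.Tendsto.const_mul ?_ (Or.inr ENNReal.ofReal_ne_top)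
      have h5 := ((continuous_enorm.tendsto g).comp hlim).comp hns.tendsto_atTop
      simpa only [Lp.enorm_def, Function.comp_def] using h5
    rw [← h4.liminf_eq]
    exact liminf_le_liminf (Eventually.of_forall fun i => hu' _)
  by_contra hne
  -- Otherwise some set `A = {|F| > C + δ}` has positive measure, and the `L^2` bound fails on its
  -- indicator function.
  have hpos : ∃ n : ℕ, rho {ζ | C + 1 / ((n : ℝ) + 1) < ‖F ζ‖} ≠ 0 := by
    by_contra! hall
    refine hne ?_
    have h1 : ∀ᵐ ζ ∂rho, ∀ n : ℕ, ‖F ζ‖ ≤ C + 1 / ((n : ℝ) + 1) := by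
      rw [ae_all_iff]
      intro n
      rw [ae_iff]
      simpa only [not_le] using hall n
    filter_upwards [h1] with ζ hζ
    refine le_of_forall_pos_le_add fun ε hε => ?_
    obtain ⟨n, hn⟩ := exists_nat_one_div_lt hε
    linarith [hζ n]
  obtain ⟨n, hn⟩ := hpos
  set δ : ℝ := 1 / ((n : ℝ) + 1) with hδ
  have hδ0 : 0 < δ := by positivity
  set A : Set InfTorus := {ζ | C + δ < ‖F ζ‖} with hA
  have hAm : MeasurableSet A :=
    measurableSet_lt measurable_const (Lp.stronglyMeasurable F).measurable.norm
  have hAfin : rho A ≠ ∞ := measure_ne_top _ _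
  have h1 := hL2 (indicatorConstLp 2 hAm hAfin (1 : ℂ))
  have h2 : eLpNorm (indicatorConstLp 2 hAm hAfin (1 : ℂ)) 2 rho = rho A ^ (1 / 2 : ℝ) := by
    rw [eLpNorm_congr_ae indicatorConstLp_coeFn, eLpNorm_indicator_const hAm (by simp) (by simp)]
    simp
  have h3 : ENNReal.ofReal (C + δ) * rho A ^ (1 / 2 : ℝ)
      ≤ eLpNorm (fun ζ => F ζ * indicatorConstLp 2 hAm hAfin (1 : ℂ) ζ) 2 rho := by
    have h4 : eLpNorm (A.indicator fun _ => ((C + δ : ℝ) : ℂ)) 2 rho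
        = ENNReal.ofReal (C + δ) * rho A ^ (1 / 2 : ℝ) := by
      rw [eLpNorm_indicator_const hAm (by simp) (by simp), ← ofReal_norm,
        Complex.norm_real, Real.norm_of_nonneg (by positivity)]
      simp
    rw [← h4]
    refine eLpNorm_mono_ae ?_
    filter_upwards [indicatorConstLp_coeFn (p := 2) (hs := hAm) (hμs := hAfin) (c := (1 : ℂ))]
      with ζ hζ
    rw [hζ]
    by_cases hmem : ζ ∈ A
    · rw [Set.indicator_of_mem hmem, Set.indicator_of_mem hmem, mul_one, Complex.norm_real,
        Real.norm_of_nonneg (by positivity)]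
      exact le_of_lt hmem
    · rw [Set.indicator_of_notMem hmem, Set.indicator_of_notMem hmem]
      simp
  rw [h2] at h1
  have h5 := h3.trans h1
  have h6 : rho A ^ (1 / 2 : ℝ) ≠ 0 := by simp [hn]
  have h7 : rho A ^ (1 / 2 : ℝ) ≠ ∞ := by simp
  rw [ENNReal.mul_le_mul_iff_left h6 h7, ENNReal.ofReal_le_ofReal_iff hC] at h5
  linarith

/-- A bounded operator from `H^2` which acts as multiplication by `F` on the monomials forces `F`
to be bounded by its norm. -/
theorem ae_norm_le_of_multiplier {F : Lp ℂ 2 rho} (A : hardySpace →L[ℂ] Lp ℂ 2 rho)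
    (hA : ∀ k, A ⟨charL2 k, charL2_mem k⟩ = mulChar k F) : ∀ᵐ ζ ∂rho, ‖F ζ‖ ≤ ‖A‖ := by
  -- By linearity `A` is multiplication by `F` on all analytic polynomials.
  have hp : ∀ p ∈ Submodule.span ℂ (Set.range bohrChar), ∃ g : hardySpace,
      (g : Lp ℂ 2 rho) = ContinuousMap.toLp 2 rho ℂ p ∧ A g =ᵐ[rho] fun ζ => F ζ * p ζ := by
    intro p hp
    induction hp using Submodule.span_induction with
    | mem x hx =>
      obtain ⟨k, rfl⟩ := hx
      refine ⟨⟨charL2 k, charL2_mem k⟩, rfl, ?_⟩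
      rw [hA]
      filter_upwards [coeFn_mulChar k F] with ζ hζ
      rw [hζ, mul_comm]
    | zero =>
      refine ⟨0, by simp, ?_⟩
      rw [map_zero]
      filter_upwards [Lp.coeFn_zero ℂ 2 rho] with ζ hζ
      rw [hζ]
      simp
    | add x y _ _ hx hy =>
      obtain ⟨g, hg, hgA⟩ := hx
      obtain ⟨g', hg', hgA'⟩ := hy
      refine ⟨g + g', by simp [hg, hg'], ?_⟩
      rw [map_add]
      filter_upwards [hgA, hgA', Lp.coeFn_add (A g) (A g')] with ζ h1 h2 h3
      rw [h3, Pi.add_apply, h1, h2, ContinuousMap.add_apply, mul_add]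
    | smul a x _ hx =>
      obtain ⟨g, hg, hgA⟩ := hx
      refine ⟨a • g, by simp [hg], ?_⟩
      rw [map_smul]
      filter_upwards [hgA, Lp.coeFn_smul a (A g)] with ζ h1 h3
      simp only [h3, h1, Pi.smul_apply, smul_eq_mul, ContinuousMap.smul_apply]
      ring
  refine ae_norm_le_of_trig A.opNorm_nonneg fun q hq => ?_
  -- Replacing `q` by the analytic polynomial `E_k q` changes neither `|q|` nor `|F q|`.
  obtain ⟨k, hk⟩ := exists_bohrChar_mul_mem hq
  obtain ⟨g, hg, hgA⟩ := hp _ hk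
  have h1 : eLpNorm (fun ζ => F ζ * q ζ) 2 rho = ‖A g‖ₑ := by
    rw [Lp.enorm_def]
    refine eLpNorm_congr_norm_ae ?_
    filter_upwards [hgA] with ζ hζ
    simp [hζ, norm_bohrChar]
  have h2 : eLpNorm q 2 rho = ‖g‖ₑ := by
    change _ = ‖(g : Lp ℂ 2 rho)‖ₑ
    rw [Lp.enorm_def, hg]
    refine eLpNorm_congr_norm_ae ?_
    filter_upwards [ContinuousMap.coeFn_toLp (p := 2) (𝕜 := ℂ) rho (bohrChar k * q)] with ζ hζ
    rw [hζ, ContinuousMap.mul_apply, norm_mul, norm_bohrChar, one_mul]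
  rw [h1, h2, ← ofReal_norm, ← ofReal_norm, ← ENNReal.ofReal_mul A.opNorm_nonneg]
  exact ENNReal.ofReal_le_ofReal (A.le_opNorm g)

/-- If `E_j F ⟂ E_k G` for all `j ≠ k`, where `F` is bounded, then `conj F * G` is constant. -/
theorem conj_mul_eq_const {F : hardySpace} (hF : IsBdd F) {G : Lp ℂ 2 rho}
    (h : ∀ j k : ℕ+, j ≠ k → inner ℂ (mulChar j F) (mulChar k G) = 0) :
    ∀ᵐ ζ ∂rho, conj ((F : Lp ℂ 2 rho) ζ) * G ζ = inner ℂ (F : Lp ℂ 2 rho) G := by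
  have hmem : MemLp (fun ζ => conj ((F : Lp ℂ 2 rho) ζ) * G ζ) 2 rho := by
    obtain ⟨C, hC⟩ := hF
    refine (Lp.memLp G).of_le_mul (c := C) ?_ ?_
    · exact (continuous_conj.comp_aestronglyMeasurable (Lp.aestronglyMeasurable _)).mul
        (Lp.aestronglyMeasurable _)
    · filter_upwards [hC] with ζ hζ
      rw [norm_mul, RCLike.norm_conj]
      exact mul_le_mul_of_nonneg_right hζ (norm_nonneg _)
  set c : ℂ := inner ℂ (F : Lp ℂ 2 rho) G with hc
  set H : Lp ℂ 2 rho := hmem.toLp _ - c • charL2 1 with hH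
  have hHcoe : H =ᵐ[rho] fun ζ => conj ((F : Lp ℂ 2 rho) ζ) * G ζ - c := by
    filter_upwards [Lp.coeFn_sub (hmem.toLp _) (c • charL2 1), Lp.coeFn_smul c (charL2 1),
      coeFn_charL2 1, hmem.coeFn_toLp] with ζ h1 h2 h3 h4
    rw [hH, h1, Pi.sub_apply, h2, h4, Pi.smul_apply, h3, map_one]
    simp
  -- `⟪E_j conj E_k, conj F * G⟫ = ⟪E_j F, E_k G⟫`, since both are the integral of the same
  -- function. It vanishes for `j ≠ k`; for `j = k` it equals `c`, which is what was subtracted in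
  -- `H`.
  have horth : ∀ j k : ℕ+,
      inner ℂ (ContinuousMap.toLp 2 rho ℂ (bohrChar j * star (bohrChar k))) H = 0 := by
    intro j k
    have h1 : inner ℂ (ContinuousMap.toLp 2 rho ℂ (bohrChar j * star (bohrChar k))) (hmem.toLp _)
        = inner ℂ (mulChar j F) (mulChar k G) := by
      rw [L2.inner_def, L2.inner_def]
      refine integral_congr_ae ?_
      filter_upwards [hmem.coeFn_toLp, coeFn_mulChar j F, coeFn_mulChar k G,
        ContinuousMap.coeFn_toLp (p := 2) (𝕜 := ℂ) rho (bohrChar j * star (bohrChar k))]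
        with ζ h1 h2 h3 h4
      simp only [h1, h2, h3, h4, RCLike.inner_apply, map_mul, ContinuousMap.mul_apply,
        ContinuousMap.star_apply, RCLike.star_def, Complex.conj_conj]
      ring
    have h2 : inner ℂ (ContinuousMap.toLp 2 rho ℂ (bohrChar j * star (bohrChar k))) (charL2 1)
        = inner ℂ (charL2 j) (charL2 k) := by
      rw [L2.inner_def, L2.inner_def]
      refine integral_congr_ae ?_
      filter_upwards [coeFn_charL2 j, coeFn_charL2 k, coeFn_charL2 1,
        ContinuousMap.coeFn_toLp (p := 2) (𝕜 := ℂ) rho (bohrChar j * star (bohrChar k))]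
        with ζ h1 h2 h3 h4
      simp only [h1, h2, h3, h4, RCLike.inner_apply, map_mul, ContinuousMap.mul_apply, map_one,
        ContinuousMap.star_apply, RCLike.star_def, Complex.conj_conj, ContinuousMap.one_apply]
      ring
    rw [hH, inner_sub_right, inner_smul_right, h1, h2]
    rcases eq_or_ne j k with rfl | hjk
    · rw [inner_self_eq_norm_sq_to_K, orthonormal_charL2.1]
      have h3 : inner ℂ (mulChar j F) (mulChar j G) = c := by
        rw [hc, L2.inner_def, L2.inner_def]
        refine integral_congr_ae ?_
        filter_upwards [coeFn_mulChar j F, coeFn_mulChar j G] with ζ h1 h2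
        have h4 := congrArg (fun p : C(InfTorus, ℂ) => p ζ) (bohrChar_mul_star j)
        simp only [ContinuousMap.mul_apply, ContinuousMap.star_apply, RCLike.star_def,
          ContinuousMap.one_apply] at h4
        simp only [h1, h2, RCLike.inner_apply, map_mul]
        linear_combination (G ζ * conj ((F : Lp ℂ 2 rho) ζ)) * h4
      rw [h3]
      simp
    · rw [h j k hjk, orthonormal_charL2.2 hjk]
      simp
  have hH0 : H = 0 := by
    have h1 : H ∈ (Submodule.span ℂ
        (ContinuousMap.toLp 2 rho ℂ '' (trigMonoid : Set C(InfTorus, ℂ))))ᗮ := by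
      rw [Submodule.mem_orthogonal]
      intro u hu
      induction hu using Submodule.span_induction with
      | mem x hx =>
        obtain ⟨_, ⟨j, k, rfl⟩, rfl⟩ := hx
        exact horth j k
      | zero => simp
      | add x y _ _ hx hy => rw [inner_add_left, hx, hy, add_zero]
      | smul a x _ hx => rw [inner_smul_left, hx, mul_zero]
    rw [← Submodule.orthogonal_closure, span_trig_dense] at h1
    simpa using h1
  have h0 : H =ᵐ[rho] 0 := by
    rw [hH0]
    exact Lp.coeFn_zero ℂ 2 rho
  filter_upwards [hHcoe, h0] with ζ h1 h2
  rw [h1] at h2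
  exact sub_eq_zero.1 h2

end PowerDilation

namespace PowerDilation

open Filter Topology

/-! ### Orthonormal bases -/

namespace DirichletSpace

variable {t : ℝ}

theorem coeff_ofCoeff (a : ℕ+ → ℂ) (ha : WeightedSummable t a) : (ofCoeff a ha).coeff = a :=
  coeff_eq _ ha.hasExpansion

theorem ext_coeff {g h : DirichletSpace t} (hgh : g.coeff = h.coeff) : g = h := by
  refine Subtype.ext (funext fun z => ?_)
  have h1 := g.hasExpansion_coeff z
  rw [hgh] at h1
  exact h1.unique (h.hasExpansion_coeff z)

theorem coeff_monomial (k : ℕ+) : (monomial t k).coeff = Pi.single k 1 := by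
  refine coeff_eq _ fun z => ?_
  convert hasSum_single (f := fun n : ℕ+ => (Pi.single k 1 : ℕ+ → ℂ) n * (z : ℂ) ^ (n : ℕ)) k
    fun n hn => by rw [Pi.single_eq_of_ne hn, zero_mul] using 1
  simp [monomial]

/-- The square root `(n + 1) ^ (t / 2)` of the weight of `D_t`. -/
def weight (t : ℝ) (n : ℕ+) : ℝ := ((n : ℝ) + 1) ^ (t / 2)

theorem weight_pos (t : ℝ) (n : ℕ+) : 0 < weight t n := by
  unfold weight
  positivity

theorem weight_sq (t : ℝ) (n : ℕ+) : weight t n ^ 2 = ((n : ℝ) + 1) ^ t := by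
  rw [weight, ← Real.rpow_natCast, ← Real.rpow_mul (by positivity)]
  norm_num

theorem memlp_iff {a : ℕ+ → ℂ} :
    Memℓp (fun n => a n * (weight t n : ℂ)) 2 ↔ WeightedSummable t a := by
  rw [memℓp_gen_iff (by norm_num), WeightedSummable]
  refine summable_congr fun n => ?_
  simp [mul_pow, ← weight_sq]

/-- `D_t` is isometric to `ℓ^2`, via `g ↦ (a n * (n + 1) ^ (t / 2))`. -/
def toL2 (t : ℝ) : DirichletSpace t ≃ₗᵢ[ℂ] lp (fun _ : ℕ+ => ℂ) 2 where
  toFun g := ⟨fun n => g.coeff n * (weight t n : ℂ), memlp_iff.2 g.weightedSummable_coeff⟩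
  map_add' g h := by
    ext n
    simp only [coeff_add, Pi.add_apply, add_mul]
    rfl
  map_smul' c g := by
    ext n
    simp [coeff_smul, mul_assoc]
  invFun x := ofCoeff (fun n => x n / (weight t n : ℂ)) (memlp_iff.1 (by
    convert lp.memℓp x using 2 with n
    exact div_mul_cancel₀ _ (by exact_mod_cast (weight_pos t n).ne')))
  left_inv g := by
    refine ext_coeff ?_
    rw [coeff_ofCoeff]
    ext n
    exact mul_div_cancel_right₀ _ (by exact_mod_cast (weight_pos t n).ne')
  right_inv x := by
    ext n
    simp only [coeff_ofCoeff]
    exact div_mul_cancel₀ _ (by exact_mod_cast (weight_pos t n).ne')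
  norm_map' g := by
    rw [← sq_eq_sq₀ (norm_nonneg _) (norm_nonneg _), norm_sq_eq]
    have h := lp.norm_rpow_eq_tsum (p := 2) (by norm_num)
      (⟨fun n => g.coeff n * (weight t n : ℂ), memlp_iff.2 g.weightedSummable_coeff⟩ :
        lp (fun _ : ℕ+ => ℂ) 2)
    simp only [ENNReal.toReal_ofNat, Real.rpow_two] at h
    refine h.trans (tsum_congr fun n => ?_)
    simp [mul_pow, ← weight_sq]

theorem toL2_apply (g : DirichletSpace t) (n : ℕ+) :
    toL2 t g n = g.coeff n * (weight t n : ℂ) := rfl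

instance : CompleteSpace (DirichletSpace t) :=
  (completeSpace_congr (e := (toL2 t).toEquiv) (toL2 t).isometry.isUniformEmbedding).2
    inferInstance

end DirichletSpace

instance : CompleteSpace hardySpace :=
  (Submodule.isClosed_topologicalClosure _).completeSpace_coe

/-- `E_n = ζ ^ α(n)` as an element of `H^2`. -/
def hardyChar (n : ℕ+) : hardySpace := ⟨charL2 n, charL2_mem n⟩

theorem orthonormal_hardyChar : Orthonormal ℂ hardyChar :=
  orthonormal_charL2.codRestrict hardySpace charL2_mem

/-- The monomials form a Hilbert basis of `H^2`. -/
def hardyBasis : HilbertBasis ℕ+ ℂ hardySpace :=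
  HilbertBasis.mkOfOrthogonalEqBot orthonormal_hardyChar (by
    rw [Submodule.eq_bot_iff]
    intro x hx
    have h1 : (x : Lp ℂ 2 rho) ∈ (Submodule.span ℂ (Set.range charL2))ᗮ := by
      rw [Submodule.mem_orthogonal]
      intro u hu
      induction hu using Submodule.span_induction with
      | mem y hy =>
        obtain ⟨n, rfl⟩ := hy
        exact (Submodule.mem_orthogonal _ _).1 hx (hardyChar n) (Submodule.subset_span ⟨n, rfl⟩)
      | zero => simp
      | add x y _ _ hx hy => rw [inner_add_left, hx, hy, add_zero]
      | smul a x _ hx => rw [inner_smul_left, hx, mul_zero]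
    rw [← Submodule.orthogonal_closure, ← hardySpace_eq] at h1
    have h2 := (Submodule.mem_orthogonal _ _).1 h1 x x.2
    exact Subtype.ext (inner_self_eq_zero.1 h2))

theorem hardyBasis_apply (n : ℕ+) : hardyBasis n = hardyChar n :=
  congrFun (HilbertBasis.coe_mkOfOrthogonalEqBot _ _) n

theorem hardyBasis_repr_hardyChar (k n : ℕ+) :
    hardyBasis.repr (hardyChar k) n = (Pi.single k 1 : ℕ+ → ℂ) n := by
  rw [← hardyBasis_apply, hardyBasis.repr_self, lp.coeFn_single]

theorem hardy_ext {x y : hardySpace} (h : ∀ n, hardyBasis.repr x n = hardyBasis.repr y n) :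
    x = y :=
  hardyBasis.repr.injective (lp.ext (funext h))

theorem hardy_clm_ext {E : Type*} [NormedAddCommGroup E] [NormedSpace ℂ E]
    {A B : hardySpace →L[ℂ] E} (h : ∀ n, A (hardyChar n) = B (hardyChar n)) : A = B := by
  refine ContinuousLinearMap.ext_on (s := Set.range hardyBasis) ?_ ?_
  · have h1 := hardyBasis.dense_span
    rwa [Submodule.dense_iff_topologicalClosure_eq_top]
  · rintro _ ⟨n, rfl⟩
    rw [hardyBasis_apply]
    exact h n

/-! ### Diagonal operators -/

theorem BddAboveBelow.ne_zero {u : ℕ+ → ℂ} (hu : BddAboveBelow u) (n : ℕ+) : u n ≠ 0 := by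
  obtain ⟨m, M, hm, h⟩ := hu
  exact norm_pos_iff.1 (hm.trans_le (h n).1)

theorem BddAboveBelow.inv {u : ℕ+ → ℂ} (hu : BddAboveBelow u) : BddAboveBelow u⁻¹ := by
  have hu0 := hu.ne_zero
  obtain ⟨m, M, hm, h⟩ := hu
  refine ⟨M⁻¹, m⁻¹, inv_pos.2 (hm.trans_le ((h 1).1.trans (h 1).2)), fun k => ?_⟩
  rw [Pi.inv_apply, norm_inv]
  exact ⟨inv_anti₀ (norm_pos_iff.2 (hu0 k)) (h k).2, inv_anti₀ hm (h k).1⟩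

/-- The diagonal operator on `ℓ^2` with bounded entries. -/
def BddAboveBelow.diagL {u : ℕ+ → ℂ} (hu : BddAboveBelow u) :
    lp (fun _ : ℕ+ => ℂ) 2 →L[ℂ] lp (fun _ : ℕ+ => ℂ) 2 :=
  lp.mapCLM 2 (fun n => u n • ContinuousLinearMap.id ℂ ℂ) (K := |hu.choose_spec.choose|)
    (abs_nonneg _) fun n => by
      rw [norm_smul, ContinuousLinearMap.norm_id, mul_one]
      exact (hu.choose_spec.choose_spec.2 n).2.trans (le_abs_self _)

theorem BddAboveBelow.diagL_apply {u : ℕ+ → ℂ} (hu : BddAboveBelow u)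
    (x : lp (fun _ : ℕ+ => ℂ) 2) (n : ℕ+) : hu.diagL x n = u n * x n := rfl

/-- The invertible diagonal operator on `ℓ^2` with entries bounded above and below. -/
def BddAboveBelow.diag {u : ℕ+ → ℂ} (hu : BddAboveBelow u) :
    lp (fun _ : ℕ+ => ℂ) 2 ≃L[ℂ] lp (fun _ : ℕ+ => ℂ) 2 :=
  ContinuousLinearEquiv.equivOfInverse hu.diagL hu.inv.diagL
    (fun x => by
      ext n
      rw [diagL_apply, diagL_apply, Pi.inv_apply, inv_mul_cancel_left₀ (hu.ne_zero n)])
    (fun x => by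
      ext n
      rw [diagL_apply, diagL_apply, Pi.inv_apply, mul_inv_cancel_left₀ (hu.ne_zero n)])

theorem BddAboveBelow.diag_apply {u : ℕ+ → ℂ} (hu : BddAboveBelow u)
    (x : lp (fun _ : ℕ+ => ℂ) 2) (n : ℕ+) : hu.diag x n = u n * x n := rfl

theorem BddAboveBelow.norm_diag {u : ℕ+ → ℂ} (hu : BddAboveBelow u) (h : ∀ n, ‖u n‖ = 1)
    (x : lp (fun _ : ℕ+ => ℂ) 2) : ‖hu.diag x‖ = ‖x‖ := by
  have h1 := lp.norm_rpow_eq_tsum (p := 2) (by norm_num) (hu.diag x)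
  have h2 := lp.norm_rpow_eq_tsum (p := 2) (by norm_num) x
  simp only [diag_apply, norm_mul, h, one_mul] at h1
  rw [← h2] at h1
  simpa [sq_eq_sq₀ (norm_nonneg _) (norm_nonneg _)] using h1

/-- The diagonal operator `E_n ↦ u n • E_n` on `H^2`. -/
def BddAboveBelow.hardyDiag {u : ℕ+ → ℂ} (hu : BddAboveBelow u) : hardySpace ≃L[ℂ] hardySpace :=
  (hardyBasis.repr.toContinuousLinearEquiv.trans hu.diag).trans
    hardyBasis.repr.symm.toContinuousLinearEquiv

theorem BddAboveBelow.repr_hardyDiag {u : ℕ+ → ℂ} (hu : BddAboveBelow u) (x : hardySpace)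
    (n : ℕ+) : hardyBasis.repr (hu.hardyDiag x) n = u n * hardyBasis.repr x n := by
  change hardyBasis.repr (hardyBasis.repr.symm (hu.diag (hardyBasis.repr x))) n = _
  rw [LinearIsometryEquiv.apply_symm_apply, diag_apply]

theorem BddAboveBelow.hardyDiag_hardyChar {u : ℕ+ → ℂ} (hu : BddAboveBelow u) (k : ℕ+) :
    hu.hardyDiag (hardyChar k) = u k • hardyChar k := by
  refine hardy_ext fun n => ?_
  rw [repr_hardyDiag, map_smul, lp.coeFn_smul, Pi.smul_apply, hardyBasis_repr_hardyChar,
    smul_eq_mul]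
  rcases eq_or_ne n k with rfl | h
  · rfl
  · simp [h]

theorem BddAboveBelow.norm_hardyDiag {u : ℕ+ → ℂ} (hu : BddAboveBelow u) (h : ∀ n, ‖u n‖ = 1)
    (x : hardySpace) : ‖hu.hardyDiag x‖ = ‖x‖ := by
  change ‖hardyBasis.repr.symm (hu.diag (hardyBasis.repr x))‖ = _
  rw [LinearIsometryEquiv.norm_map, hu.norm_diag h, LinearIsometryEquiv.norm_map]

/-! ### The Bohr transform as an isomorphism -/

theorem repr_bohr (g : DirichletSpace 0) (n : ℕ+) : hardyBasis.repr (bohr g) n = g.coeff n := by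
  rw [hardyBasis.repr_apply_apply, hardyBasis_apply]
  change inner ℂ (charL2 n) (∑' n : ℕ+, g.coeff n • charL2 n) = _
  rw [← innerSL_apply_apply ℂ, (innerSL ℂ (charL2 n)).map_tsum (summable_bohr g),
    tsum_eq_single n]
  · rw [innerSL_apply_apply, inner_smul_right, inner_self_eq_norm_sq_to_K, orthonormal_charL2.1]
    simp
  · intro m hm
    rw [innerSL_apply_apply, inner_smul_right, orthonormal_charL2.2 hm.symm, mul_zero]

theorem repr_bohrT {t : ℝ} (g : DirichletSpace t) (n : ℕ+) :
    hardyBasis.repr (bohrT g) n = g.coeff n * (((n : ℝ) ^ (t / 2) : ℝ) : ℂ) := by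
  rw [bohrT, repr_bohr, DirichletSpace.shift, DirichletSpace.coeff_ofCoeff]

theorem bohrT_zero (g : DirichletSpace 0) : bohrT g = bohr g := by
  refine hardy_ext fun n => ?_
  rw [repr_bohrT, repr_bohr]
  simp

/-- `ℬ_t` uses `n ^ (t / 2)` while the norm uses `(n + 1) ^ (t / 2)`. Since `n / (n + 1)` lies in
`[1 / 2, 1]`, the two are comparable, and `ℬ_t` is an isomorphism. -/
theorem bddAboveBelow_weight_ratio (t : ℝ) :
    BddAboveBelow fun n : ℕ+ => (((n : ℝ) ^ (t / 2) / DirichletSpace.weight t n : ℝ) : ℂ) := by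
  have key : ∀ n : ℕ+, (n : ℝ) ^ (t / 2) / DirichletSpace.weight t n
      = ((n : ℝ) / (n + 1)) ^ (t / 2) := fun n => by
    rw [DirichletSpace.weight, Real.div_rpow (by positivity) (by positivity)]
  have hhalf : ∀ n : ℕ+, (1 / 2 : ℝ) ≤ (n : ℝ) / (n + 1) ∧ (n : ℝ) / (n + 1) ≤ 1 := fun n => by
    have hn : (1 : ℝ) ≤ (n : ℝ) := by exact_mod_cast n.pos
    constructor
    · rw [le_div_iff₀ (by positivity)]
      linarith
    · rw [div_le_one (by positivity)]
      linarith
  have hnn : ∀ n : ℕ+, 0 ≤ ((n : ℝ) / (n + 1)) ^ (t / 2) := fun n => by positivity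
  simp only [key]
  refine ⟨min 1 ((1 / 2) ^ (t / 2)), max 1 ((1 / 2) ^ (t / 2)), by positivity, fun n => ?_⟩
  rw [Complex.norm_real, Real.norm_of_nonneg (hnn n)]
  obtain ⟨h1, h2⟩ := hhalf n
  rcases le_total 0 (t / 2) with ht | ht
  · exact ⟨(min_le_right _ _).trans (Real.rpow_le_rpow (by norm_num) h1 ht),
      (Real.rpow_le_one (by positivity) h2 ht).trans (le_max_left _ _)⟩
  · exact ⟨(min_le_left _ _).trans (Real.one_le_rpow_of_pos_of_le_one_of_nonpos
        (by positivity) h2 ht),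
      (Real.rpow_le_rpow_of_nonpos (by norm_num) h1 ht).trans (le_max_right _ _)⟩

/-- The transform `ℬ_t` as an isomorphism of `D_t` onto `H^2`. -/
def bohrEquiv (t : ℝ) : DirichletSpace t ≃L[ℂ] hardySpace :=
  ((DirichletSpace.toL2 t).toContinuousLinearEquiv.trans (bddAboveBelow_weight_ratio t).diag).trans
    hardyBasis.repr.symm.toContinuousLinearEquiv

theorem bohrEquiv_apply {t : ℝ} (g : DirichletSpace t) : bohrEquiv t g = bohrT g := by
  refine hardy_ext fun n => ?_
  change hardyBasis.repr (hardyBasis.repr.symm ((bddAboveBelow_weight_ratio t).diag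
    (DirichletSpace.toL2 t g))) n = _
  rw [LinearIsometryEquiv.apply_symm_apply, BddAboveBelow.diag_apply, repr_bohrT,
    DirichletSpace.toL2_apply]
  have h : (DirichletSpace.weight t n : ℂ) ≠ 0 := by
    exact_mod_cast (DirichletSpace.weight_pos t n).ne'
  push_cast
  field_simp

theorem norm_bohrEquiv_zero (g : DirichletSpace 0) : ‖bohrEquiv 0 g‖ = ‖g‖ := by
  change ‖hardyBasis.repr.symm ((bddAboveBelow_weight_ratio 0).diag
    (DirichletSpace.toL2 0 g))‖ = _
  rw [LinearIsometryEquiv.norm_map, BddAboveBelow.norm_diag, LinearIsometryEquiv.norm_map]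
  intro n
  simp [DirichletSpace.weight]

theorem bohrEquiv_monomial (t : ℝ) (k : ℕ+) :
    bohrEquiv t (DirichletSpace.monomial t k)
      = (((k : ℝ) ^ (t / 2) : ℝ) : ℂ) • hardyChar k := by
  refine hardy_ext fun n => ?_
  rw [bohrEquiv_apply, repr_bohrT, DirichletSpace.coeff_monomial, map_smul, lp.coeFn_smul,
    Pi.smul_apply, hardyBasis_repr_hardyChar, smul_eq_mul]
  rcases eq_or_ne n k with rfl | h
  · rw [mul_comm]
  · simp [h]

/-! ### Dilations -/

/-- Multiplication by `E_k` on `H^2`. -/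
def charMul (k : ℕ+) (F : hardySpace) : hardySpace := ⟨mulChar k F, mulChar_mem k F.2⟩

theorem norm_charMul (k : ℕ+) (F : hardySpace) : ‖charMul k F‖ = ‖F‖ := norm_mulChar k F

theorem mul_left_injective_pnat (k : ℕ+) : Function.Injective fun n : ℕ+ => k * n :=
  fun _ _ h => mul_left_cancel h

/-- Because `E_k E_m = E_{km}`, coefficients move from `m` to `k * m`; the default `0` of
`Function.extend` serves the indices not divisible by `k`. -/
theorem repr_charMul (k : ℕ+) (F : hardySpace) (n : ℕ+) :
    hardyBasis.repr (charMul k F) n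
      = Function.extend (fun n => k * n) (fun m => hardyBasis.repr F m) 0 n := by
  let A : hardySpace →L[ℂ] hardySpace :=
    ((mulChar k).comp hardySpace.subtypeL).codRestrict hardySpace fun g => mulChar_mem k g.2
  have hA : ∀ m, A (hardyChar m) = hardyChar (k * m) := fun m =>
    Subtype.ext (mulChar_charL2 k m)
  have h1 := (hardyBasis.hasSum_repr F).mapL ((innerSL ℂ (hardyChar n)).comp A)
  have h2 : HasSum (fun m => hardyBasis.repr F m * inner ℂ (hardyChar n) (hardyChar (k * m)))
      (hardyBasis.repr (charMul k F) n) := by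
    rw [hardyBasis.repr_apply_apply, hardyBasis_apply]
    have h3 : (fun m => hardyBasis.repr F m * inner ℂ (hardyChar n) (hardyChar (k * m)))
        = fun m => ((innerSL ℂ (hardyChar n)).comp A) (hardyBasis.repr F m • hardyBasis m) := by
      funext m
      rw [hardyBasis_apply, map_smul, ContinuousLinearMap.comp_apply, hA, innerSL_apply_apply,
        smul_eq_mul]
    rw [h3]
    exact h1
  have hon : ∀ i j : ℕ+, inner ℂ (hardyChar i) (hardyChar j) = if i = j then (1 : ℂ) else 0 :=
    orthonormal_iff_ite.1 orthonormal_hardyChar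
  refine h2.unique ?_
  by_cases hn : ∃ m, k * m = n
  · obtain ⟨m, rfl⟩ := hn
    rw [(mul_left_injective_pnat k).extend_apply]
    convert hasSum_single m fun j hj => ?_ using 1
    · simp [hon]
    · rw [hon, if_neg fun h => hj (mul_left_cancel h).symm, mul_zero]
  · rw [Function.extend_apply' _ _ _ hn]
    have h3 : (fun m => hardyBasis.repr F m * inner ℂ (hardyChar n) (hardyChar (k * m)))
        = fun _ => 0 := by
      funext m
      rw [hon, if_neg fun h => hn ⟨m, h.symm⟩, mul_zero]
    rw [h3]
    exact hasSum_zero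

/-- The weights at `k n` and `n` are compared through `n + 1 ≤ k n + 1 ≤ k (n + 1)`: the upper bound
serves `t ≥ 0`, the lower one `t ≤ 0`. -/
theorem WeightedSummable.extend {t : ℝ} {a : ℕ+ → ℂ} (ha : WeightedSummable t a) (k : ℕ+) :
    WeightedSummable t (Function.extend (fun n => k * n) a 0) := by
  unfold WeightedSummable
  rw [← (mul_left_injective_pnat k).summable_iff]
  · refine Summable.of_nonneg_of_le (fun n => by rw [Function.comp_apply]; positivity) (fun n => ?_)
      (Summable.mul_left (max 1 ((k : ℝ) ^ t)) ha)
    rw [Function.comp_apply, (mul_left_injective_pnat k).extend_apply]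
    have hk : (1 : ℝ) ≤ (k : ℝ) := by exact_mod_cast k.pos
    have hn : (1 : ℝ) ≤ (n : ℝ) := by exact_mod_cast n.pos
    have h2 : (((k * n : ℕ+) : ℕ) : ℝ) + 1 = (k : ℝ) * n + 1 := by push_cast; rfl
    have h1 : ((((k * n : ℕ+) : ℕ) : ℝ) + 1) ^ t ≤ max 1 ((k : ℝ) ^ t) * ((n : ℝ) + 1) ^ t := by
      have hw : 0 ≤ ((n : ℝ) + 1) ^ t := by positivity
      rw [h2]
      rcases le_total 0 t with ht | ht
      · calc ((k : ℝ) * n + 1) ^ t ≤ (k * ((n : ℝ) + 1)) ^ t :=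
              Real.rpow_le_rpow (by positivity) (by nlinarith) ht
          _ = (k : ℝ) ^ t * ((n : ℝ) + 1) ^ t := Real.mul_rpow (by positivity) (by positivity)
          _ ≤ _ := mul_le_mul_of_nonneg_right (le_max_right _ _) hw
      · calc ((k : ℝ) * n + 1) ^ t ≤ ((n : ℝ) + 1) ^ t :=
              Real.rpow_le_rpow_of_nonpos (by positivity) (by nlinarith) ht
          _ = 1 * ((n : ℝ) + 1) ^ t := (one_mul _).symm
          _ ≤ _ := mul_le_mul_of_nonneg_right (le_max_left _ _) hw
    calc _ ≤ ‖a n‖ ^ 2 * (max 1 ((k : ℝ) ^ t) * ((n : ℝ) + 1) ^ t) :=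
          mul_le_mul_of_nonneg_left h1 (by positivity)
      _ = _ := by ring
  · intro n hn
    rw [Function.extend_apply' _ _ _ hn]
    simp

namespace DirichletSpace

variable {t : ℝ}

/-- The function `z ↦ f (z ^ k)`. -/
def dilate (f : DirichletSpace t) (k : ℕ+) : DirichletSpace t :=
  ofCoeff _ (f.weightedSummable_coeff.extend k)

theorem coeff_dilate (f : DirichletSpace t) (k : ℕ+) :
    (dilate f k).coeff = Function.extend (fun n => k * n) f.coeff 0 := coeff_ofCoeff _ _

theorem dilate_apply (f : DirichletSpace t) (k : ℕ+) (z : 𝔻) : dilate f k z = f (z ^ k) := by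
  have h1 := (dilate f k).hasExpansion_coeff z
  have h2 := f.hasExpansion_coeff (z ^ k)
  rw [coeff_dilate] at h1
  refine h1.unique ?_
  rw [← (mul_left_injective_pnat k).hasSum_iff]
  · convert h2 using 2 with n
    rw [Function.comp_apply, (mul_left_injective_pnat k).extend_apply]
    simp [pow_mul]
  · intro n hn
    rw [Function.extend_apply' _ _ _ hn]
    simp

end DirichletSpace

open DirichletSpace

/-- This is where the completely multiplicative factor `n ^ (t / 2)` in `ℬ_t` matters: `(k m) ^ (t /
2)` splits, which would fail for `(k m + 1) ^ (t / 2)`. -/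
theorem bohrEquiv_dilate {t : ℝ} (f : DirichletSpace t) (k : ℕ+) :
    bohrEquiv t (dilate f k) = (((k : ℝ) ^ (t / 2) : ℝ) : ℂ) • charMul k (bohrT f) := by
  refine hardy_ext fun n => ?_
  rw [bohrEquiv_apply, repr_bohrT, coeff_dilate, map_smul, lp.coeFn_smul, Pi.smul_apply,
    repr_charMul, smul_eq_mul]
  by_cases hn : ∃ m, k * m = n
  · obtain ⟨m, rfl⟩ := hn
    rw [(mul_left_injective_pnat k).extend_apply, (mul_left_injective_pnat k).extend_apply,
      repr_bohrT, PNat.mul_coe, Nat.cast_mul, Real.mul_rpow (by positivity) (by positivity)]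
    push_cast
    ring
  · rw [Function.extend_apply' _ _ _ hn, Function.extend_apply' _ _ _ hn]
    simp

theorem solvesMoment_iff {t : ℝ} {f : DirichletSpace t} {lam : ℕ+ → ℂ}
    {T : DirichletSpace t →L[ℂ] DirichletSpace t} :
    SolvesMoment f lam T ↔ ∀ k, T (monomial t k) = lam k • dilate f k := by
  refine forall_congr' fun k => ⟨fun h => Subtype.ext (funext fun z => ?_), fun h z => ?_⟩
  · refine (h z).trans ?_
    rw [← dilate_apply]
    rfl
  · rw [h, ← dilate_apply]
    rfl

/-- The moment problem in `D_t` is equivalent to a multiplication problem in `H^2`. -/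
theorem solvesMoment_iff_hardy {t : ℝ} {f : DirichletSpace t} {lam : ℕ+ → ℂ}
    {T : DirichletSpace t →L[ℂ] DirichletSpace t} :
    SolvesMoment f lam T ↔
      ∀ k, bohrEquiv t (T ((bohrEquiv t).symm (hardyChar k))) = lam k • charMul k (bohrT f) := by
  rw [solvesMoment_iff]
  refine forall_congr' fun k => ?_
  have hk : (((k : ℝ) ^ (t / 2) : ℝ) : ℂ) ≠ 0 := by
    have : (0 : ℝ) < (k : ℝ) ^ (t / 2) := by
      have : (0 : ℝ) < k := by exact_mod_cast k.pos
      positivity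
    exact_mod_cast this.ne'
  have h1 : monomial t k
      = (((k : ℝ) ^ (t / 2) : ℝ) : ℂ) • (bohrEquiv t).symm (hardyChar k) := by
    rw [← map_smul, ← bohrEquiv_monomial, ContinuousLinearEquiv.symm_apply_apply]
  -- The monomial and the dilation contribute the same nonzero factor `k ^ (t / 2)`, which cancels.
  rw [h1, map_smul, ← (bohrEquiv t).injective.eq_iff, map_smul, map_smul, bohrEquiv_dilate,
    smul_comm (lam k), (smul_right_injective _ hk).eq_iff]

end PowerDilation

namespace PowerDilation

open DirichletSpace

/-! ### The conjugated operator on `H^2` -/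

/-- The operator on `H^2` corresponding to `T` under the isomorphism `ℬ_t`. -/
def hardyConj {t : ℝ} (T : DirichletSpace t →L[ℂ] DirichletSpace t) :
    hardySpace →L[ℂ] hardySpace :=
  ((bohrEquiv t : DirichletSpace t →L[ℂ] hardySpace).comp T).comp
    ((bohrEquiv t).symm : hardySpace →L[ℂ] DirichletSpace t)

theorem hardyConj_apply {t : ℝ} (T : DirichletSpace t →L[ℂ] DirichletSpace t) (x : hardySpace) :
    hardyConj T x = bohrEquiv t (T ((bohrEquiv t).symm x)) := rfl

/-- The operator on `D_t` corresponding to `S` under the isomorphism `ℬ_t`. -/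
def dirichletConj (t : ℝ) (S : hardySpace →L[ℂ] hardySpace) :
    DirichletSpace t →L[ℂ] DirichletSpace t :=
  (((bohrEquiv t).symm : hardySpace →L[ℂ] DirichletSpace t).comp S).comp
    (bohrEquiv t : DirichletSpace t →L[ℂ] hardySpace)

theorem dirichletConj_apply {t : ℝ} (S : hardySpace →L[ℂ] hardySpace) (x : DirichletSpace t) :
    dirichletConj t S x = (bohrEquiv t).symm (S (bohrEquiv t x)) := rfl

theorem solvesMoment_dirichletConj {t : ℝ} {f : DirichletSpace t} {lam : ℕ+ → ℂ}
    {S : hardySpace →L[ℂ] hardySpace}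
    (hS : ∀ k, S (hardyChar k) = lam k • charMul k (bohrT f)) :
    SolvesMoment f lam (dirichletConj t S) := by
  rw [solvesMoment_iff_hardy]
  intro k
  rw [dirichletConj_apply, ContinuousLinearEquiv.apply_symm_apply,
    ContinuousLinearEquiv.apply_symm_apply, hS]

theorem bohrT_ne_zero {t : ℝ} {f : DirichletSpace t} (hf : f ≠ 0) : bohrT f ≠ 0 := by
  rw [← bohrEquiv_apply]
  exact fun h => hf ((bohrEquiv t).injective (h.trans (map_zero _).symm))

theorem ne_zero_of_norm_eq_one {t : ℝ} {f : DirichletSpace t} (hf : ‖f‖ = 1) : f ≠ 0 := by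
  rintro rfl
  simp at hf

theorem IsBdd.mulHardy_hardyChar {F : hardySpace} (hF : IsBdd F) (k : ℕ+) :
    hF.mulHardy (hardyChar k) = charMul k F :=
  Subtype.ext (hF.mulLp_charL2 k)

theorem norm_hardyChar (k : ℕ+) : ‖hardyChar k‖ = 1 := orthonormal_hardyChar.1 k

theorem isBdd_of_hardyChar {F : hardySpace} (A : hardySpace →L[ℂ] hardySpace)
    (hA : ∀ k, A (hardyChar k) = charMul k F) : IsBdd F :=
  ⟨_, ae_norm_le_of_multiplier (hardySpace.subtypeL.comp A)
    fun k => congrArg Subtype.val (hA k)⟩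

/-! ### Operators on `H^2` with `S E_k = λ_k E_k F` -/

section Multiplier

variable {S : hardySpace →L[ℂ] hardySpace} {F : hardySpace} {lam : ℕ+ → ℂ}

/-- Removes the `λ_k`, leaving multiplication by `F` alone. -/
theorem comp_hardyDiag_inv (hlam : BddAboveBelow lam)
    (hS : ∀ k, S (hardyChar k) = lam k • charMul k F) (k : ℕ+) :
    S (hlam.inv.hardyDiag (hardyChar k)) = charMul k F := by
  rw [BddAboveBelow.hardyDiag_hardyChar, map_smul, hS, Pi.inv_apply,
    inv_smul_smul₀ (hlam.ne_zero k)]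

theorem isBdd_of_hardyChar_smul (hlam : BddAboveBelow lam)
    (hS : ∀ k, S (hardyChar k) = lam k • charMul k F) : IsBdd F :=
  isBdd_of_hardyChar (S.comp (hlam.inv.hardyDiag : hardySpace →L[ℂ] hardySpace))
    (comp_hardyDiag_inv hlam hS)

theorem mulHardy_hardyDiag (hF : IsBdd F) (hlam : BddAboveBelow lam) (k : ℕ+) :
    hF.mulHardy (hlam.hardyDiag (hardyChar k)) = lam k • charMul k F := by
  rw [BddAboveBelow.hardyDiag_hardyChar, map_smul, hF.mulHardy_hardyChar]

/-- Multiplication by `E_k` is isometric, so `‖S E_k‖ = |λ_k| ‖F‖`. -/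
theorem norm_lam_le (hF : F ≠ 0) (hS : ∀ k, S (hardyChar k) = lam k • charMul k F) (k : ℕ+) :
    ‖lam k‖ ≤ ‖S‖ / ‖F‖ := by
  rw [le_div_iff₀ (norm_pos_iff.2 hF)]
  have h := S.le_opNorm (hardyChar k)
  rwa [hS, norm_smul, norm_charMul, norm_hardyChar, mul_one] at h

theorem repr_charMul_self (k : ℕ+) : hardyBasis.repr (charMul k F) k = hardyBasis.repr F 1 := by
  have h := (mul_left_injective_pnat k).extend_apply (fun m => hardyBasis.repr F m) 0 1
  rw [repr_charMul]
  simpa using h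

/-- The matrix of `S` in the basis `E_n` is triangular. -/
theorem repr_apply_of_forall_lt (hS : ∀ k, S (hardyChar k) = lam k • charMul k F)
    {g : hardySpace} {j : ℕ+} (hg : ∀ m < j, hardyBasis.repr g m * lam m = 0) :
    hardyBasis.repr (S g) j = hardyBasis.repr g j * lam j * hardyBasis.repr F 1 := by
  have h1 := (hardyBasis.hasSum_repr g).mapL ((innerSL ℂ (hardyChar j)).comp S)
  have h2 : (fun m => ((innerSL ℂ (hardyChar j)).comp S) (hardyBasis.repr g m • hardyBasis m))
      = fun m => hardyBasis.repr g m * lam m * hardyBasis.repr (charMul m F) j := by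
    funext m
    rw [hardyBasis_apply, map_smul, ContinuousLinearMap.comp_apply, hS, map_smul,
      innerSL_apply_apply, hardyBasis.repr_apply_apply (charMul m F), hardyBasis_apply,
      smul_eq_mul, smul_eq_mul, mul_assoc]
  rw [h2, ContinuousLinearMap.comp_apply, innerSL_apply_apply, ← hardyBasis_apply,
    ← hardyBasis.repr_apply_apply] at h1
  have h3 := hasSum_single (f := fun m => hardyBasis.repr g m * lam m
    * hardyBasis.repr (charMul m F) j) j fun m hm => by
      -- Terms with `m < j` vanish by hypothesis. For `m > j` the index `j` is not a multiple of
      -- `m`, so `E_m F` has no coefficient there.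
      rcases lt_or_ge m j with h | h
      · rw [hg m h, zero_mul]
      · rw [repr_charMul, Function.extend_apply', Pi.zero_apply, mul_zero]
        rintro ⟨i, rfl⟩
        refine hm (le_antisymm ?_ h)
        calc m = m * 1 := (mul_one m).symm
          _ ≤ m * i := mul_le_mul_right one_le m
  rw [repr_charMul_self] at h3
  exact h1.unique h3

/-- Only `E_1` contributes to the first coefficient of `S g`, with the factor `F_1`; if `F_1` were
zero, `E_1` would not be attained. -/
theorem repr_one_ne_zero (hS : ∀ k, S (hardyChar k) = lam k • charMul k F)
    (hsurj : Function.Surjective S) : hardyBasis.repr F 1 ≠ 0 := by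
  intro h0
  obtain ⟨g, hg⟩ := hsurj (hardyChar 1)
  have h := repr_apply_of_forall_lt hS (g := g) (j := 1) fun m hm => absurd hm one_le.not_gt
  rw [hg, hardyBasis_repr_hardyChar, h0] at h
  simp at h

/-- Forward substitution in the triangular system: the products `g_m λ_m` with `m < n` vanish one
after another, and then row `n` reads off the identity. -/
theorem repr_mul_lam_eq (hS : ∀ k, S (hardyChar k) = lam k • charMul k F)
    (hF : hardyBasis.repr F 1 ≠ 0) {g : hardySpace} {n : ℕ+} (hg : S g = hardyChar n) :
    hardyBasis.repr g n * lam n * hardyBasis.repr F 1 = 1 := by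
  have key : ∀ m < n, hardyBasis.repr g m * lam m = 0 := by
    intro m
    induction m using PNat.strongInductionOn with
    | _ m ih =>
      intro hm
      have h := repr_apply_of_forall_lt hS (g := g) (j := m) fun i hi => ih i hi (hi.trans hm)
      rw [hg, hardyBasis_repr_hardyChar, Pi.single_eq_of_ne hm.ne] at h
      exact (mul_eq_zero.1 h.symm).resolve_right hF
  rw [← repr_apply_of_forall_lt hS key, hg, hardyBasis_repr_hardyChar, Pi.single_eq_same]

/-- The open mapping theorem gives preimages `g` of `E_k` with `‖g‖ ≤ C`. Then `g_k λ_k F_1 = 1` and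
`|g_k| ≤ C` bound `|λ_k|` from below. -/
theorem bddAboveBelow_of_surjective (hF : F ≠ 0)
    (hS : ∀ k, S (hardyChar k) = lam k • charMul k F) (hsurj : Function.Surjective S) :
    BddAboveBelow lam := by
  have hF1 := repr_one_ne_zero hS hsurj
  obtain ⟨C, hC, h⟩ := S.exists_preimage_norm_le hsurj
  have hF1' : 0 < ‖hardyBasis.repr F 1‖ := norm_pos_iff.2 hF1
  refine ⟨(C * ‖hardyBasis.repr F 1‖)⁻¹, ‖S‖ / ‖F‖, by positivity, fun k =>
    ⟨?_, norm_lam_le hF hS k⟩⟩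
  obtain ⟨g, hg, hgC⟩ := h (hardyChar k)
  rw [norm_hardyChar, mul_one] at hgC
  have h1 := congrArg norm (repr_mul_lam_eq hS hF1 hg)
  rw [norm_mul, norm_mul, norm_one] at h1
  have h2 : ‖hardyBasis.repr g k‖ ≤ C := by
    refine (lp.norm_apply_le_norm (by norm_num) _ k).trans ?_
    rwa [LinearIsometryEquiv.norm_map]
  rw [inv_le_iff_one_le_mul₀ (by positivity), ← h1]
  calc ‖hardyBasis.repr g k‖ * ‖lam k‖ * ‖hardyBasis.repr F 1‖
      ≤ C * ‖lam k‖ * ‖hardyBasis.repr F 1‖ := by gcongr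
    _ = _ := by ring

/-- A preimage `G` of `E_1 = 1` under multiplication by `F` satisfies `F G = 1`. Hence `F ≠ 0`
almost everywhere and the multiplication is bijective; its bounded inverse sends `E_k` to `E_k G`,
so `G` is itself a multiplier and therefore bounded. -/
theorem isInvertibleHInf_of_surjective (hlam : BddAboveBelow lam)
    (hS : ∀ k, S (hardyChar k) = lam k • charMul k F) (hsurj : Function.Surjective S) :
    IsInvertibleHInf F := by
  have hF : IsBdd F := isBdd_of_hardyChar_smul hlam hS
  have hM : hF.mulHardy = S.comp (hlam.inv.hardyDiag : hardySpace →L[ℂ] hardySpace) :=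
    hardy_clm_ext fun k => (hF.mulHardy_hardyChar k).trans (comp_hardyDiag_inv hlam hS k).symm
  have hMsurj : Function.Surjective hF.mulHardy := by
    rw [hM]
    exact hsurj.comp hlam.inv.hardyDiag.surjective
  obtain ⟨G, hG⟩ := hMsurj (hardyChar 1)
  have hFG : ∀ᵐ ζ ∂rho, (F : Lp ℂ 2 rho) ζ * (G : Lp ℂ 2 rho) ζ = 1 := by
    have h1 := hF.coeFn_mulHardy G
    rw [hG] at h1
    filter_upwards [h1, coeFn_charL2 1] with ζ h2 h3
    rw [← h2]
    refine h3.trans ?_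
    rw [map_one, ContinuousMap.one_apply]
  have hMinj : Function.Injective hF.mulHardy := by
    rw [injective_iff_map_eq_zero]
    intro x hx
    have h1 := hF.coeFn_mulHardy x
    rw [hx] at h1
    refine Subtype.ext (Lp.ext ?_)
    filter_upwards [h1, hFG, Lp.coeFn_zero ℂ 2 rho] with ζ h2 h3 h4
    rw [ZeroMemClass.coe_zero, h4, Pi.zero_apply] at h2
    rw [ZeroMemClass.coe_zero, h4, Pi.zero_apply]
    refine (mul_eq_zero.1 h2.symm).resolve_left fun h0 => ?_
    rw [h0, zero_mul] at h3
    exact zero_ne_one h3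
  let M : hardySpace ≃L[ℂ] hardySpace := ContinuousLinearEquiv.ofBijective hF.mulHardy
    (LinearMap.ker_eq_bot.2 hMinj) (LinearMap.range_eq_top.2 hMsurj)
  have hMG : ∀ k, M (charMul k G) = hardyChar k := by
    intro k
    refine Subtype.ext (Lp.ext ?_)
    filter_upwards [hF.coeFn_mulHardy (charMul k G), coeFn_mulChar k G, hFG, coeFn_charL2 k]
      with ζ h1 h2 h3 h4
    refine h1.trans (Eq.trans ?_ h4.symm)
    change (F : Lp ℂ 2 rho) ζ * mulChar k G ζ = _
    rw [h2, mul_left_comm, h3, mul_one]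
  refine ⟨hF, G, isBdd_of_hardyChar (M.symm : hardySpace →L[ℂ] hardySpace) fun k => ?_, hFG⟩
  change M.symm (hardyChar k) = _
  rw [← hMG, ContinuousLinearEquiv.symm_apply_apply]

theorem IsInvertibleHInf.bijective_mulHardy (hF : IsInvertibleHInf F) :
    Function.Bijective hF.1.mulHardy := by
  obtain ⟨hF, G, hG, hFG⟩ := hF
  refine Function.bijective_iff_has_inverse.2 ⟨hG.mulHardy, fun x => ?_, fun x => ?_⟩
  · refine Subtype.ext (Lp.ext ?_)
    filter_upwards [hG.coeFn_mulHardy (hF.mulHardy x), hF.coeFn_mulHardy x, hFG] with ζ h1 h2 h3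
    rw [h1, h2, ← mul_assoc, mul_comm ((G : Lp ℂ 2 rho) ζ), h3, one_mul]
  · refine Subtype.ext (Lp.ext ?_)
    filter_upwards [hF.coeFn_mulHardy (hG.mulHardy x), hG.coeFn_mulHardy x, hFG] with ζ h1 h2 h3
    rw [h1, h2, ← mul_assoc, h3, one_mul]

end Multiplier

/-! ### Bounded, surjective and invertible solutions -/

section Solutions

variable {t : ℝ} {f : DirichletSpace t} {lam : ℕ+ → ℂ}

theorem exists_solution_iff (hlam : BddAboveBelow lam) :
    (∃ T : DirichletSpace t →L[ℂ] DirichletSpace t, SolvesMoment f lam T) ↔ IsBdd (bohrT f) := by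
  constructor
  · rintro ⟨T, hT⟩
    exact isBdd_of_hardyChar_smul (S := hardyConj T) hlam (solvesMoment_iff_hardy.1 hT)
  · intro hF
    exact ⟨_, solvesMoment_dirichletConj
      (S := hF.mulHardy.comp (hlam.hardyDiag : hardySpace →L[ℂ] hardySpace))
      (mulHardy_hardyDiag hF hlam)⟩

theorem conditions_of_surjective (hf : f ≠ 0) {T : DirichletSpace t →L[ℂ] DirichletSpace t}
    (hT : SolvesMoment f lam T) (hsurj : Function.Surjective T) :
    IsInvertibleHInf (bohrT f) ∧ BddAboveBelow lam := by
  have hS := solvesMoment_iff_hardy.1 hT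
  have hSsurj : Function.Surjective (hardyConj T) :=
    ((bohrEquiv t).surjective.comp hsurj).comp (bohrEquiv t).symm.surjective
  have hlam := bddAboveBelow_of_surjective (S := hardyConj T) (bohrT_ne_zero hf) hS hSsurj
  exact ⟨isInvertibleHInf_of_surjective hlam hS hSsurj, hlam⟩

theorem exists_isUnit_solution (hF : IsInvertibleHInf (bohrT f)) (hlam : BddAboveBelow lam) :
    ∃ T : DirichletSpace t →L[ℂ] DirichletSpace t, SolvesMoment f lam T ∧ IsUnit T := by
  refine ⟨_, solvesMoment_dirichletConj
    (S := hF.1.mulHardy.comp (hlam.hardyDiag : hardySpace →L[ℂ] hardySpace))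
    (mulHardy_hardyDiag hF.1 hlam), ?_⟩
  rw [ContinuousLinearMap.isUnit_iff_bijective]
  exact ((bohrEquiv t).symm.bijective.comp
    (hF.bijective_mulHardy.comp hlam.hardyDiag.bijective)).comp (bohrEquiv t).bijective

theorem exists_isUnit_solution_iff (hf : f ≠ 0) :
    (∃ T : DirichletSpace t →L[ℂ] DirichletSpace t, SolvesMoment f lam T ∧ IsUnit T) ↔
      IsInvertibleHInf (bohrT f) ∧ BddAboveBelow lam := by
  constructor
  · rintro ⟨T, hT, hu⟩
    exact conditions_of_surjective hf hT (ContinuousLinearMap.isUnit_iff_bijective.1 hu).2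
  · rintro ⟨hF, hlam⟩
    exact exists_isUnit_solution hF hlam

theorem exists_surjective_solution_iff (hf : f ≠ 0) :
    (∃ T : DirichletSpace t →L[ℂ] DirichletSpace t,
        SolvesMoment f lam T ∧ Function.Surjective T) ↔
      IsInvertibleHInf (bohrT f) ∧ BddAboveBelow lam := by
  constructor
  · rintro ⟨T, hT, hsurj⟩
    exact conditions_of_surjective hf hT hsurj
  · rintro ⟨hF, hlam⟩
    obtain ⟨T, hT, hu⟩ := exists_isUnit_solution hF hlam
    exact ⟨T, hT, (ContinuousLinearMap.isUnit_iff_bijective.1 hu).2⟩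

end Solutions

/-! ### Isometric solutions in `H_0^2` -/

theorem inner_map_map_of_isometry {E : Type*} [NormedAddCommGroup E] [InnerProductSpace ℂ E]
    {T : E →L[ℂ] E} (hT : Isometry T) (x y : E) : inner ℂ (T x) (T y) = inner ℂ x y :=
  LinearIsometry.inner_map_map
    (⟨T, (AddMonoidHomClass.isometry_iff_norm T).1 hT⟩ : E →ₗᵢ[ℂ] E) x y

theorem exists_isometric_solution_zero_iff {f : DirichletSpace 0} {lam : ℕ+ → ℂ} (hf : ‖f‖ = 1) :
    (∃ T : DirichletSpace 0 →L[ℂ] DirichletSpace 0, SolvesMoment f lam T ∧ Isometry T) ↔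
      IsInner (bohr f) ∧ ∀ k, ‖lam k‖ = 1 := by
  rw [← bohrT_zero]
  have hB : Isometry (bohrEquiv 0) :=
    (AddMonoidHomClass.isometry_iff_norm _).2 norm_bohrEquiv_zero
  have hB' : Isometry (bohrEquiv 0).symm := hB.right_inv (bohrEquiv 0).apply_symm_apply
  have hFnorm : ‖bohrT f‖ = 1 := by rw [← bohrEquiv_apply, norm_bohrEquiv_zero, hf]
  constructor
  · rintro ⟨T, hT, hiso⟩
    have hS := solvesMoment_iff_hardy.1 hT
    have hSiso : Isometry (hardyConj T) := (hB.comp hiso).comp hB'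
    have hlam : ∀ k, ‖lam k‖ = 1 := by
      intro k
      have h1 := (AddMonoidHomClass.isometry_iff_norm _).1 hSiso (hardyChar k)
      rw [hardyConj_apply, hS, norm_smul, norm_charMul, hFnorm, norm_hardyChar, mul_one] at h1
      exact h1
    have hlamB : BddAboveBelow lam := ⟨1, 1, one_pos, fun k => ⟨(hlam k).ge, (hlam k).le⟩⟩
    have hF : IsBdd (bohrT f) := isBdd_of_hardyChar_smul (S := hardyConj T) hlamB hS
    refine ⟨?_, hlam⟩
    -- `S` preserves the orthogonality of the `E_k`, and the nonzero `λ_k` divide out.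
    have horth : ∀ j k : ℕ+, j ≠ k →
        inner ℂ (mulChar j (bohrT f)) (mulChar k (bohrT f)) = 0 := by
      intro j k hjk
      have h1 := inner_map_map_of_isometry hSiso (hardyChar j) (hardyChar k)
      rw [hardyConj_apply, hardyConj_apply, hS, hS, orthonormal_hardyChar.2 hjk] at h1
      change inner ℂ (lam j • mulChar j (bohrT f)) (lam k • mulChar k (bohrT f)) = 0 at h1
      rw [inner_smul_left, inner_smul_right, mul_eq_zero, mul_eq_zero] at h1
      have h2 : conj (lam j) ≠ 0 := by simpa using hlamB.ne_zero j
      exact (h1.resolve_left h2).resolve_left (hlamB.ne_zero k)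
    filter_upwards [conj_mul_eq_const hF horth] with ζ hζ
    have h1 : inner ℂ (bohrT f : Lp ℂ 2 rho) (bohrT f : Lp ℂ 2 rho) = (1 : ℂ) := by
      have h2 : ‖(bohrT f : Lp ℂ 2 rho)‖ = 1 := hFnorm
      rw [inner_self_eq_norm_sq_to_K, h2]
      simp
    rw [h1] at hζ
    have h3 := congrArg norm hζ
    rw [norm_mul, RCLike.norm_conj, norm_one, ← sq] at h3
    exact (pow_eq_one_iff_of_nonneg (norm_nonneg _) two_ne_zero).1 h3
  · rintro ⟨hin, hlam⟩
    have hlamB : BddAboveBelow lam := ⟨1, 1, one_pos, fun k => ⟨(hlam k).ge, (hlam k).le⟩⟩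
    have hF : IsBdd (bohrT f) := ⟨1, hin.mono fun ζ h => h.le⟩
    refine ⟨_, solvesMoment_dirichletConj
      (S := hF.mulHardy.comp (hlamB.hardyDiag : hardySpace →L[ℂ] hardySpace))
      (mulHardy_hardyDiag hF hlamB), ?_⟩
    have hM : Isometry hF.mulHardy := by
      refine (AddMonoidHomClass.isometry_iff_norm _).2 fun x => ?_
      change ‖(hF.mulHardy x : Lp ℂ 2 rho)‖ = ‖(x : Lp ℂ 2 rho)‖
      rw [Lp.norm_def, Lp.norm_def]
      congr 1
      refine eLpNorm_congr_norm_ae ?_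
      filter_upwards [hF.coeFn_mulHardy x, hin] with ζ h1 h2
      rw [h1, norm_mul, h2, one_mul]
    have hD : Isometry hlamB.hardyDiag :=
      (AddMonoidHomClass.isometry_iff_norm _).2 (hlamB.norm_hardyDiag hlam)
    exact (hB'.comp (hM.comp hD)).comp hB

end PowerDilation

namespace PowerDilation

open DirichletSpace Filter Topology

/-! ### Isometric solutions for `t ≠ 0` -/

/-- A Lipschitz bound on `[0, 1]`; it supplies the dominating sequences for both limits below. -/
theorem exists_abs_one_add_rpow_sub_one_le (t : ℝ) :
    ∃ K : ℝ, 0 ≤ K ∧ ∀ x ∈ Set.Icc (0 : ℝ) 1, |(1 + x) ^ t - 1| ≤ K * x := by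
  have hd : ContDiffOn ℝ 1 (fun x : ℝ => (1 + x) ^ t) (Set.Icc 0 1) := fun x hx =>
    ((contDiffAt_const.add contDiffAt_id).rpow_const_of_ne
      (by have := hx.1; simp only [id]; linarith)).contDiffWithinAt
  obtain ⟨K, hK⟩ := hd.exists_lipschitzOnWith one_ne_zero (convex_Icc 0 1) isCompact_Icc
  refine ⟨K, K.2, fun x hx => ?_⟩
  have h := hK.dist_le_mul x hx 0 (by simp)
  simpa [Real.dist_eq, abs_of_nonneg hx.1] using h

theorem hasDerivAt_one_add_rpow (t : ℝ) : HasDerivAt (fun x : ℝ => (1 + x) ^ t) t 0 := by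
  have h := ((hasDerivAt_id (0 : ℝ)).const_add 1).rpow_const (p := t) (Or.inl (by simp))
  simpa using h

/-- First two terms of the expansion of `∑ s n * (1 + 1 / (d * n)) ^ t` as `d → ∞`. -/
theorem tsum_eq_zero_of_forall_dilate {t : ℝ} (ht : t ≠ 0) {s : ℕ+ → ℂ} (hs : Summable s)
    (h : ∀ d : ℕ+, ∑' n : ℕ+, s n * (((1 + 1 / ((d : ℝ) * n)) ^ t : ℝ) : ℂ) = 0) :
    ∑' n, s n = 0 ∧ ∑' n : ℕ+, s n / n = 0 := by
  obtain ⟨K, hK0, hK⟩ := exists_abs_one_add_rpow_sub_one_le t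
  have hsn : Summable fun n => ‖s n‖ := hs.norm
  -- The natural number `d` stands for the dilation `d + 1`, to avoid dividing by zero.
  have hx : ∀ (d : ℕ) (n : ℕ+), 1 / (((d + 1 : ℕ) : ℝ) * n) ∈ Set.Icc (0 : ℝ) 1 := fun d n => by
    have hd : (1 : ℝ) ≤ ((d + 1 : ℕ) : ℝ) := by exact_mod_cast Nat.succ_pos d
    have hn : (1 : ℝ) ≤ (n : ℝ) := by exact_mod_cast n.pos
    exact ⟨by positivity, by rw [div_le_one (by positivity)]; nlinarith⟩
  have hlim : ∀ n : ℕ+, Tendsto (fun d : ℕ => 1 / (((d + 1 : ℕ) : ℝ) * n)) atTop (𝓝[≠] 0) := by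
    intro n
    have hn : (0 : ℝ) < (n : ℝ) := by exact_mod_cast n.pos
    refine tendsto_nhdsWithin_iff.2 ⟨?_, Eventually.of_forall fun d => ?_⟩
    · have h1 : Tendsto (fun d : ℕ => 1 / ((d : ℝ) + 1) * (1 / (n : ℝ))) atTop (𝓝 (0 * (1 / n))) :=
        tendsto_one_div_add_atTop_nhds_zero_nat.mul_const _
      rw [zero_mul] at h1
      refine h1.congr fun d => ?_
      push_cast
      rw [one_div_mul_one_div]
    · have : 1 / (((d + 1 : ℕ) : ℝ) * n) ≠ 0 := by positivity
      exact this
  have hzero : ∀ d : ℕ,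
      ∑' n : ℕ+, s n * (((1 + 1 / (((d + 1 : ℕ) : ℝ) * n)) ^ t : ℝ) : ℂ) = 0 := fun d =>
    h ⟨d + 1, d.succ_pos⟩
  have hbd : ∀ (d : ℕ) (n : ℕ+), |(1 + 1 / (((d + 1 : ℕ) : ℝ) * n)) ^ t| ≤ K + 1 := fun d n => by
    have h1 := hK _ (hx d n)
    have h2 : K * (1 / (((d + 1 : ℕ) : ℝ) * n)) ≤ K * 1 :=
      mul_le_mul_of_nonneg_left (hx d n).2 hK0
    have h3 := abs_sub_abs_le_abs_sub ((1 + 1 / (((d + 1 : ℕ) : ℝ) * n)) ^ t) 1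
    rw [abs_one] at h3
    linarith
  have hbdC : ∀ (d : ℕ) (n : ℕ+),
      ‖s n * (((1 + 1 / (((d + 1 : ℕ) : ℝ) * n)) ^ t : ℝ) : ℂ)‖ ≤ ‖s n‖ * (K + 1) := fun d n => by
    rw [norm_mul, Complex.norm_real, Real.norm_eq_abs]
    exact mul_le_mul_of_nonneg_left (hbd d n) (norm_nonneg _)
  have hsum : ∀ d : ℕ,
      Summable fun n : ℕ+ => s n * (((1 + 1 / (((d + 1 : ℕ) : ℝ) * n)) ^ t : ℝ) : ℂ) := fun d =>
    Summable.of_norm_bounded (hsn.mul_right (K + 1)) (hbdC d)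
  have h0 : ∑' n, s n = 0 := by
    have h1 := tendsto_tsum_of_dominated_convergence (𝓕 := atTop)
      (f := fun (d : ℕ) (n : ℕ+) => s n * (((1 + 1 / (((d + 1 : ℕ) : ℝ) * n)) ^ t : ℝ) : ℂ))
      (g := s) (hsn.mul_right (K + 1)) (fun n => ?_) (Eventually.of_forall hbdC)
    · simp only [hzero] at h1
      exact (tendsto_nhds_unique h1 tendsto_const_nhds)
    · have h2 := (hasDerivAt_one_add_rpow t).continuousAt.tendsto.comp
        ((hlim n).mono_right nhdsWithin_le_nhds)
      simp only [add_zero, Real.one_rpow] at h2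
      have h3 := ((Complex.continuous_ofReal.tendsto 1).comp h2).const_mul (s n)
      rw [Complex.ofReal_one, mul_one] at h3
      exact h3
  refine ⟨h0, ?_⟩
  -- Since `∑ s n = 0`, it may be subtracted and the difference scaled by `d + 1`. The terms are
  -- then difference quotients of `(1 + x) ^ t` at `0`, with limit `t * s n / n` and bound `K ‖s
  -- n‖`.
  have h1 := tendsto_tsum_of_dominated_convergence (𝓕 := atTop)
    (f := fun (d : ℕ) (n : ℕ+) => ((d + 1 : ℕ) : ℂ) *
      (s n * (((1 + 1 / (((d + 1 : ℕ) : ℝ) * n)) ^ t : ℝ) : ℂ) - s n))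
    (g := fun n => t * (s n / n)) (hsn.mul_right K) (fun n => ?_)
    (Eventually.of_forall fun d n => ?_)
  · have h2 : ∀ d : ℕ, ∑' n : ℕ+, ((d + 1 : ℕ) : ℂ) *
        (s n * (((1 + 1 / (((d + 1 : ℕ) : ℝ) * n)) ^ t : ℝ) : ℂ) - s n) = 0 := fun d => by
      rw [tsum_mul_left, (hsum d).tsum_sub hs, hzero, h0]
      simp
    simp only [h2, tsum_mul_left] at h1
    have h3 := tendsto_nhds_unique h1 tendsto_const_nhds
    exact (mul_eq_zero.1 h3).resolve_left (by exact_mod_cast ht)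
  · have hn : (n : ℂ) ≠ 0 := by exact_mod_cast n.ne_zero
    have h2 := (hasDerivAt_iff_tendsto_slope_zero.1 (hasDerivAt_one_add_rpow t)).comp (hlim n)
    have h3 := ((Complex.continuous_ofReal.tendsto t).comp h2).mul_const (s n / n)
    refine h3.congr fun d => ?_
    have hd : ((d : ℂ) + 1) ≠ 0 := by exact_mod_cast d.succ_ne_zero
    simp only [Function.comp_apply, zero_add, add_zero, Real.one_rpow, smul_eq_mul]
    push_cast
    field_simp
  · have hn : (0 : ℝ) < (n : ℝ) := by exact_mod_cast n.pos
    have hn1 : (1 : ℝ) ≤ (n : ℝ) := by exact_mod_cast n.pos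
    have hd : (0 : ℝ) < ((d + 1 : ℕ) : ℝ) := by positivity
    have h2 : s n * (((1 + 1 / (((d + 1 : ℕ) : ℝ) * n)) ^ t : ℝ) : ℂ) - s n
        = s n * (((1 + 1 / (((d + 1 : ℕ) : ℝ) * n)) ^ t - 1 : ℝ) : ℂ) := by
      push_cast
      ring
    rw [h2, norm_mul, norm_mul, Complex.norm_real, Real.norm_eq_abs, Complex.norm_natCast,
      mul_left_comm]
    refine mul_le_mul_of_nonneg_left ?_ (norm_nonneg _)
    calc ((d + 1 : ℕ) : ℝ) * |(1 + 1 / (((d + 1 : ℕ) : ℝ) * n)) ^ t - 1|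
        ≤ ((d + 1 : ℕ) : ℝ) * (K * (1 / (((d + 1 : ℕ) : ℝ) * n))) :=
          mul_le_mul_of_nonneg_left (hK _ (hx d n)) hd.le
      _ = K / n := by field_simp
      _ ≤ K := div_le_self hK0 hn1

/-! ### Orthogonality of dilations and rigidity for `t ≠ 0` -/

section Isometric

variable {t : ℝ}

theorem dilate_dilate (f : DirichletSpace t) (k d : ℕ+) :
    dilate (dilate f k) d = dilate f (d * k) := by
  refine Subtype.ext (funext fun z => ?_)
  refine (dilate_apply _ _ _).trans ((dilate_apply _ _ _).trans
    (Eq.trans ?_ (dilate_apply _ _ _).symm))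
  refine congrArg (f : 𝔻 → ℂ) (UnitDisc.coe_injective ?_)
  simp [pow_mul]

theorem inner_eq_tsum (g h : DirichletSpace t) :
    inner ℂ g h = ∑' n : ℕ+, conj (g.coeff n) * h.coeff n * ((((n : ℝ) + 1) ^ t : ℝ) : ℂ) := rfl

theorem inner_dilate_dilate (g h : DirichletSpace t) (d : ℕ+) :
    inner ℂ (dilate g d) (dilate h d)
      = ∑' n : ℕ+, conj (g.coeff n) * h.coeff n * ((((d : ℝ) * n + 1) ^ t : ℝ) : ℂ) := by
  rw [inner_eq_tsum, coeff_dilate, coeff_dilate, ← (mul_left_injective_pnat d).tsum_eq]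
  · refine tsum_congr fun n => ?_
    rw [(mul_left_injective_pnat d).extend_apply, (mul_left_injective_pnat d).extend_apply]
    push_cast
    rfl
  · intro n hn
    by_contra hc
    rw [Function.mem_support, Function.extend_apply' _ _ _ hc] at hn
    simp at hn

/-- Parseval in `H^2`: the leading weight `n ^ t` of the expansion is exactly the one that `ℬ_t`
turns into the `H^2` inner product. -/
theorem hasSum_inner_bohrEquiv (g h : DirichletSpace t) :
    HasSum (fun n : ℕ+ => conj (g.coeff n) * h.coeff n * (((n : ℝ) ^ t : ℝ) : ℂ))
      (inner ℂ (bohrEquiv t g) (bohrEquiv t h)) := by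
  have h1 := hardyBasis.hasSum_inner_mul_inner (bohrEquiv t g) (bohrEquiv t h)
  have h2 : (fun n => inner ℂ (bohrEquiv t g) (hardyBasis n)
      * inner ℂ (hardyBasis n) (bohrEquiv t h))
      = fun n : ℕ+ => conj (g.coeff n) * h.coeff n * (((n : ℝ) ^ t : ℝ) : ℂ) := by
    funext n
    have h3 : (n : ℝ) ^ t = (n : ℝ) ^ (t / 2) * (n : ℝ) ^ (t / 2) := by
      rw [← Real.rpow_add (by exact_mod_cast n.pos), add_halves]
    have h4 : inner ℂ (bohrEquiv t g) (hardyBasis n)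
        = conj (hardyBasis.repr (bohrEquiv t g) n) := by
      rw [hardyBasis.repr_apply_apply]
      exact (inner_conj_symm (𝕜 := ℂ) (bohrEquiv t g) (hardyBasis n)).symm
    rw [h4, ← hardyBasis.repr_apply_apply, bohrEquiv_apply, bohrEquiv_apply, repr_bohrT,
      repr_bohrT, map_mul, Complex.conj_ofReal, h3]
    push_cast
    ring
  rw [h2] at h1
  exact h1

theorem inner_mulChar_eq_zero {f g : DirichletSpace t} {j k : ℕ+}
    (h : ∑' n : ℕ+, conj ((dilate f j).coeff n) * (dilate g k).coeff n * (((n : ℝ) ^ t : ℝ) : ℂ)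
      = 0) :
    inner ℂ (mulChar j (bohrT f)) (mulChar k (bohrT g)) = 0 := by
  have hpow : ∀ i : ℕ+, (((i : ℝ) ^ (t / 2) : ℝ) : ℂ) ≠ 0 := fun i => by
    have h1 : (0 : ℝ) < i := by exact_mod_cast i.pos
    exact_mod_cast (Real.rpow_pos_of_pos h1 (t / 2)).ne'
  have h1 := (hasSum_inner_bohrEquiv (dilate f j) (dilate g k)).tsum_eq
  rw [h, bohrEquiv_dilate, bohrEquiv_dilate] at h1
  change 0 = inner ℂ ((((j : ℝ) ^ (t / 2) : ℝ) : ℂ) • mulChar j (bohrT f))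
    ((((k : ℝ) ^ (t / 2) : ℝ) : ℂ) • mulChar k (bohrT g)) at h1
  rw [inner_smul_left, inner_smul_right, Complex.conj_ofReal] at h1
  exact (mul_eq_zero.1 ((mul_eq_zero.1 h1.symm).resolve_left (hpow j))).resolve_left (hpow k)

theorem inner_monomial_of_ne {j k : ℕ+} (h : j ≠ k) :
    inner ℂ (monomial t j) (monomial t k) = 0 := by
  rw [inner_eq_tsum, coeff_monomial, coeff_monomial]
  refine (tsum_congr fun n => ?_).trans tsum_zero
  rcases eq_or_ne n j with rfl | hn
  · rw [Pi.single_eq_of_ne h, mul_zero, zero_mul]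
  · rw [Pi.single_eq_of_ne hn, map_zero, zero_mul, zero_mul]

theorem toL2_monomial (k : ℕ+) :
    toL2 t (monomial t k) = lp.single 2 k (weight t k : ℂ) := by
  ext n
  rw [toL2_apply, coeff_monomial, lp.coeFn_single]
  rcases eq_or_ne n k with rfl | hn
  · simp
  · simp [hn]

theorem norm_monomial (k : ℕ+) : ‖monomial t k‖ = weight t k := by
  rw [← (toL2 t).norm_map, toL2_monomial, lp.norm_single (by norm_num), Complex.norm_real,
    Real.norm_of_nonneg (weight_pos t k).le]

theorem dilate_smul_monomial (c : ℂ) (N k : ℕ+) :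
    dilate (c • monomial t N) k = c • monomial t (k * N) := by
  refine ext_coeff ?_
  rw [coeff_dilate, coeff_smul, coeff_smul, coeff_monomial, coeff_monomial]
  funext n
  by_cases hn : ∃ m, k * m = n
  · obtain ⟨m, rfl⟩ := hn
    rw [(mul_left_injective_pnat k).extend_apply, Pi.smul_apply, Pi.smul_apply]
    rcases eq_or_ne m N with rfl | hm
    · simp
    · rw [Pi.single_eq_of_ne hm, Pi.single_eq_of_ne fun h => hm (mul_left_cancel h)]
  · rw [Function.extend_apply' _ _ _ hn, Pi.smul_apply,
      Pi.single_eq_of_ne fun h => hn ⟨N, h.symm⟩]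
    simp

/-- The numerator is `(k + 1) (N + 1)`, so the formula is a ratio of weights; it expresses `‖λ_k c z
^ (k * N)‖ = ‖z ^ k‖` when `x = |λ_k|`. -/
theorem norm_lam_eq_iff {c : ℂ} {N k : ℕ+} {x : ℝ} (hc : ‖c‖ = ((N : ℝ) + 1) ^ (-(t / 2))) :
    x = (((k : ℝ) * N + k + N + 1) / ((k : ℝ) * N + 1)) ^ (t / 2) ↔
      x * (‖c‖ * weight t (k * N)) = weight t k := by
  have h1 : (((k : ℝ) * N + k + N + 1) / ((k : ℝ) * N + 1)) ^ (t / 2)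
      = weight t k * ((N : ℝ) + 1) ^ (t / 2) / weight t (k * N) := by
    rw [weight, weight, ← Real.mul_rpow (by positivity) (by positivity),
      ← Real.div_rpow (by positivity) (by positivity)]
    push_cast
    ring_nf
  have h2 := weight_pos t (k * N)
  have h3 : 0 < ((N : ℝ) + 1) ^ (t / 2) := by positivity
  rw [h1, hc, Real.rpow_neg (by positivity)]
  field_simp

/-- A function of `D_t` with coefficients `a n / n`. -/
def divIndex (f : DirichletSpace t) : DirichletSpace t :=
  ofCoeff (fun n => f.coeff n / n) (by
    refine Summable.of_nonneg_of_le (fun n => by positivity) (fun n => ?_)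
      f.weightedSummable_coeff
    have hn : (1 : ℝ) ≤ (n : ℝ) := by exact_mod_cast n.pos
    rw [norm_div, Complex.norm_natCast]
    gcongr
    exact div_le_self (norm_nonneg _) hn)

theorem coeff_divIndex (f : DirichletSpace t) (n : ℕ+) :
    (divIndex f).coeff n = f.coeff n / n :=
  congrFun (coeff_ofCoeff _ _) n

/-- The expansion divides by the index after dilation, `k * m`, whereas `divIndex` divides by `m`;
the factor `k` reconciles the two. -/
theorem coeff_dilate_divIndex (f : DirichletSpace t) (k n : ℕ+) :
    (dilate (divIndex f) k).coeff n = k * ((dilate f k).coeff n / n) := by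
  rw [coeff_dilate, coeff_dilate]
  by_cases hn : ∃ m, k * m = n
  · obtain ⟨m, rfl⟩ := hn
    rw [(mul_left_injective_pnat k).extend_apply, (mul_left_injective_pnat k).extend_apply,
      coeff_divIndex]
    have hk : (k : ℂ) ≠ 0 := by exact_mod_cast k.ne_zero
    have hm : (m : ℂ) ≠ 0 := by exact_mod_cast m.ne_zero
    push_cast
    field_simp
  · rw [Function.extend_apply' _ _ _ hn, Function.extend_apply' _ _ _ hn]
    simp

variable {f : DirichletSpace t} {lam : ℕ+ → ℂ}

/-- Asymptotic orthogonality relations. -/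
theorem tsum_eq_zero_of_orthogonal (ht : t ≠ 0) {j k : ℕ+}
    (h : ∀ d : ℕ+, inner ℂ (dilate f (d * j)) (dilate f (d * k)) = 0) :
    inner ℂ (mulChar j (bohrT f)) (mulChar k (bohrT f)) = 0 ∧
      inner ℂ (mulChar j (bohrT f)) (mulChar k (bohrT (divIndex f))) = 0 := by
  have hs := (hasSum_inner_bohrEquiv (dilate f j) (dilate f k)).summable
  obtain ⟨h0, h1⟩ := tsum_eq_zero_of_forall_dilate ht hs fun d => by
    have hd : (0 : ℝ) < d := by exact_mod_cast d.pos
    have h2 := h d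
    rw [← dilate_dilate, ← dilate_dilate, inner_dilate_dilate] at h2
    -- The weight factors as `(d n + 1) ^ t = d ^ t n ^ t (1 + 1 / (d n)) ^ t`, and the constant `d
    -- ^ t` drops out.
    have h3 : ∀ n : ℕ+, conj ((dilate f j).coeff n) * (dilate f k).coeff n
        * ((((d : ℝ) * n + 1) ^ t : ℝ) : ℂ) = (((d : ℝ) ^ t : ℝ) : ℂ) *
        (conj ((dilate f j).coeff n) * (dilate f k).coeff n * (((n : ℝ) ^ t : ℝ) : ℂ)
          * (((1 + 1 / ((d : ℝ) * n)) ^ t : ℝ) : ℂ)) := fun n => by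
      have hn : (0 : ℝ) < n := by exact_mod_cast n.pos
      have h4 : ((d : ℝ) * n + 1) ^ t
          = (d : ℝ) ^ t * ((n : ℝ) ^ t * (1 + 1 / ((d : ℝ) * n)) ^ t) := by
        rw [← Real.mul_rpow (by positivity) (by positivity),
          ← Real.mul_rpow (by positivity) (by positivity)]
        congr 1
        field_simp
      rw [h4]
      push_cast
      ring
    simp only [h3] at h2
    rw [tsum_mul_left] at h2
    refine (mul_eq_zero.1 h2).resolve_left ?_
    exact_mod_cast (Real.rpow_pos_of_pos hd t).ne'
  refine ⟨inner_mulChar_eq_zero h0, inner_mulChar_eq_zero ?_⟩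
  have h2 : ∀ n : ℕ+, conj ((dilate f j).coeff n) * (dilate (divIndex f) k).coeff n
      * (((n : ℝ) ^ t : ℝ) : ℂ) = k * (conj ((dilate f j).coeff n) * (dilate f k).coeff n
      * (((n : ℝ) ^ t : ℝ) : ℂ) / n) := fun n => by
    rw [coeff_dilate_divIndex]
    ring
  simp only [h2]
  rw [tsum_mul_left, h1, mul_zero]

/-- With `B = ℬ_t`, `B' = B⁻¹` and `F = ℬ_t f`, isometry gives `1 = ‖E_k‖ ≤ ‖B‖ ‖B' E_k‖ = ‖B‖ ‖T B'
E_k‖ ≤ ‖B‖ ‖B'‖ |λ_k| ‖F‖`. -/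
theorem bddAboveBelow_of_isometry (hf : f ≠ 0) {T : DirichletSpace t →L[ℂ] DirichletSpace t}
    (hT : SolvesMoment f lam T) (hiso : Isometry T) : BddAboveBelow lam := by
  have hS := solvesMoment_iff_hardy.1 hT
  have hF := bohrT_ne_zero hf
  set B : DirichletSpace t →L[ℂ] hardySpace := (bohrEquiv t : DirichletSpace t →L[ℂ] hardySpace)
    with hB
  set B' : hardySpace →L[ℂ] DirichletSpace t :=
    ((bohrEquiv t).symm : hardySpace →L[ℂ] DirichletSpace t) with hB'
  have hBn := B.opNorm_nonneg
  have hBn' := B'.opNorm_nonneg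
  have hQ : 0 ≤ ‖B‖ * (‖B'‖ * ‖bohrT f‖) :=
    mul_nonneg hBn (mul_nonneg hBn' (norm_nonneg _))
  -- The added `1` only makes the denominator visibly positive.
  refine ⟨(‖B‖ * (‖B'‖ * ‖bohrT f‖) + 1)⁻¹, ‖hardyConj T‖ / ‖bohrT f‖, by positivity, fun k =>
    ⟨?_, norm_lam_le (S := hardyConj T) hF hS k⟩⟩
  rw [inv_le_iff_one_le_mul₀ (by positivity)]
  have h1 : ‖B' (hardyChar k)‖ ≤ ‖B'‖ * (‖lam k‖ * ‖bohrT f‖) := by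
    rw [← (AddMonoidHomClass.isometry_iff_norm T).1 hiso]
    have h2 : T (B' (hardyChar k)) = B' (lam k • charMul k (bohrT f)) := by
      rw [← hS k]
      exact ((bohrEquiv t).symm_apply_apply _).symm
    rw [h2]
    refine (B'.le_opNorm _).trans_eq ?_
    rw [norm_smul, norm_charMul]
  have h3 : (1 : ℝ) ≤ ‖B‖ * ‖B' (hardyChar k)‖ := by
    refine le_of_eq_of_le ?_ (B.le_opNorm (B' (hardyChar k)))
    rw [← norm_hardyChar k]
    exact congrArg norm ((bohrEquiv t).apply_symm_apply _).symm
  have h4 := h3.trans (mul_le_mul_of_nonneg_left h1 hBn)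
  nlinarith [norm_nonneg (lam k)]

/-- If `F = ℬ_t f` and the transform `F₁` of `∑ (a n / n) z ^ n` satisfy `E_j F ⟂ E_k F` and
`E_j F ⟂ E_k F₁` for all `j ≠ k`, then `f` is a monomial. -/
theorem eq_smul_monomial_of_orthogonal (hf : f ≠ 0) (hF : IsBdd (bohrT f))
    (h1 : ∀ j k : ℕ+, j ≠ k → inner ℂ (mulChar j (bohrT f)) (mulChar k (bohrT f)) = 0)
    (h2 : ∀ j k : ℕ+, j ≠ k →
      inner ℂ (mulChar j (bohrT f)) (mulChar k (bohrT (divIndex f))) = 0) :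
    ∃ (N : ℕ+) (c : ℂ), f = c • monomial t N := by
  have hc1 := conj_mul_eq_const hF h1
  have hc2 := conj_mul_eq_const hF h2
  set κ : ℂ := inner ℂ (bohrT f : Lp ℂ 2 rho) (bohrT f : Lp ℂ 2 rho) with hκ
  set c : ℂ := inner ℂ (bohrT f : Lp ℂ 2 rho) (bohrT (divIndex f) : Lp ℂ 2 rho) with hc
  have hκ0 : κ ≠ 0 := fun h0 =>
    bohrT_ne_zero hf (Subtype.ext (inner_self_eq_zero.1 h0))
  -- Both sides equal `conj F * F * F₁` pointwise.
  have heq : κ • bohrT (divIndex f) = c • bohrT f := by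
    refine Subtype.ext (Lp.ext ?_)
    filter_upwards [hc1, hc2, Lp.coeFn_smul κ (bohrT (divIndex f) : Lp ℂ 2 rho),
      Lp.coeFn_smul c (bohrT f : Lp ℂ 2 rho)] with ζ e1 e2 e3 e4
    refine e3.trans (Eq.trans ?_ e4.symm)
    rw [Pi.smul_apply, Pi.smul_apply, smul_eq_mul, smul_eq_mul, ← e1, ← e2]
    ring
  -- Comparison of coefficients: `κ a_n / n = c a_n`. As `κ ≠ 0`, this determines `n`.
  have hcoef : ∀ n : ℕ+, f.coeff n ≠ 0 → κ = c * n := by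
    intro n hn
    have e1 := congrArg (fun x => hardyBasis.repr x n) heq
    simp only [map_smul, lp.coeFn_smul, Pi.smul_apply, smul_eq_mul, repr_bohrT,
      coeff_divIndex] at e1
    have hn0 : (n : ℂ) ≠ 0 := by exact_mod_cast n.ne_zero
    have hpow : (((n : ℝ) ^ (t / 2) : ℝ) : ℂ) ≠ 0 := by
      have h1 : (0 : ℝ) < n := by exact_mod_cast n.pos
      exact_mod_cast (Real.rpow_pos_of_pos h1 (t / 2)).ne'
    field_simp at e1
    linear_combination e1
  obtain ⟨N, hN⟩ : ∃ N, f.coeff N ≠ 0 := by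
    by_contra! hall
    exact hf (eq_zero_of_coeff f (funext hall))
  refine ⟨N, f.coeff N, ext_coeff ?_⟩
  rw [coeff_smul, coeff_monomial]
  funext n
  rw [Pi.smul_apply, smul_eq_mul]
  rcases eq_or_ne n N with rfl | hn
  · simp
  · rw [Pi.single_eq_of_ne hn, mul_zero]
    by_contra h0
    have e1 := (hcoef n h0).symm.trans (hcoef N hN)
    have hc0 : c ≠ 0 := by
      rintro h
      exact hκ0 (by rw [hcoef N hN, h, zero_mul])
    have e2 := mul_left_cancel₀ hc0 e1
    exact hn (PNat.coe_injective (by exact_mod_cast e2))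

/-- The normalized monomials `z ^ k / ‖z ^ k‖` must go to multiples of `z ^ (k * N)`. These are
orthogonal for distinct `k`, and the hypothesis says that they have norm one. -/
theorem exists_isometric_solution_of_monomial {c : ℂ} {N : ℕ+}
    (h : ∀ k, ‖lam k‖ * (‖c‖ * weight t (k * N)) = weight t k) :
    ∃ T : DirichletSpace t →L[ℂ] DirichletSpace t,
      SolvesMoment (c • monomial t N) lam T ∧ Isometry T := by
  have hw : ∀ k, (weight t k : ℂ) ≠ 0 := fun k => by exact_mod_cast (weight_pos t k).ne'
  let v : ℕ+ → DirichletSpace t := fun k =>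
    ((weight t k : ℂ)⁻¹ * (lam k * c)) • monomial t (k * N)
  have hv : Orthonormal ℂ v := by
    refine ⟨fun k => ?_, fun j k hjk => ?_⟩
    · have hk := weight_pos t k
      simp only [v, norm_smul, norm_mul, norm_inv, norm_monomial, Complex.norm_real,
        Real.norm_of_nonneg hk.le]
      rw [mul_assoc, mul_assoc, h, inv_mul_cancel₀ hk.ne']
    · simp only [v]
      rw [inner_smul_left, inner_smul_right,
        inner_monomial_of_ne fun h => hjk (mul_right_cancel h), mul_zero, mul_zero]
  let T : DirichletSpace t →ₗᵢ[ℂ] DirichletSpace t :=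
    hv.orthogonalFamily.linearIsometry.comp (toL2 t).toLinearIsometry
  refine ⟨T.toContinuousLinearMap, solvesMoment_iff.2 fun k => ?_, T.isometry⟩
  change hv.orthogonalFamily.linearIsometry (toL2 t (monomial t k)) = _
  rw [toL2_monomial, OrthogonalFamily.linearIsometry_apply_single, dilate_smul_monomial,
    LinearIsometry.toSpanSingleton_apply, smul_smul, smul_smul, mul_inv_cancel_left₀ (hw k)]

theorem exists_isometric_solution_iff (ht : t ≠ 0) (hf : ‖f‖ = 1) :
    (∃ T : DirichletSpace t →L[ℂ] DirichletSpace t, SolvesMoment f lam T ∧ Isometry T) ↔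
      ∃ (N : ℕ+) (c : ℂ), f = c • monomial t N ∧ ‖c‖ = ((N : ℝ) + 1) ^ (-(t / 2)) ∧
        ∀ k : ℕ+, ‖lam k‖ =
          (((k : ℝ) * N + k + N + 1) / ((k : ℝ) * N + 1)) ^ (t / 2) := by
  constructor
  · rintro ⟨T, hT, hiso⟩
    have hf0 := ne_zero_of_norm_eq_one hf
    have hlam := bddAboveBelow_of_isometry hf0 hT hiso
    have hF : IsBdd (bohrT f) := (exists_solution_iff hlam).1 ⟨T, hT⟩
    have hTk := solvesMoment_iff.1 hT
    have horth : ∀ j k : ℕ+, j ≠ k → inner ℂ (dilate f j) (dilate f k) = 0 := by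
      intro j k hjk
      have h1 := inner_map_map_of_isometry hiso (monomial t j) (monomial t k)
      rw [hTk, hTk, inner_monomial_of_ne hjk, inner_smul_left, inner_smul_right, mul_eq_zero,
        mul_eq_zero] at h1
      have h2 : conj (lam j) ≠ 0 := by simpa using hlam.ne_zero j
      exact (h1.resolve_left h2).resolve_left (hlam.ne_zero k)
    -- Orthogonality for one pair `(j, k)` is used along the whole family `(d * j, d * k)`, which
    -- lets `d → ∞`.
    have hasym := fun (j k : ℕ+) (hjk : j ≠ k) =>
      tsum_eq_zero_of_orthogonal (f := f) ht fun d =>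
        horth (d * j) (d * k) fun h => hjk (mul_left_cancel h)
    obtain ⟨N, c, rfl⟩ := eq_smul_monomial_of_orthogonal hf0 hF
      (fun j k hjk => (hasym j k hjk).1) fun j k hjk => (hasym j k hjk).2
    have hc : ‖c‖ = ((N : ℝ) + 1) ^ (-(t / 2)) := by
      rw [norm_smul, norm_monomial, weight] at hf
      rw [Real.rpow_neg (by positivity)]
      exact eq_inv_of_mul_eq_one_left hf
    refine ⟨N, c, rfl, hc, fun k => (norm_lam_eq_iff hc).2 ?_⟩
    have h1 := (AddMonoidHomClass.isometry_iff_norm T).1 hiso (monomial t k)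
    rwa [hTk, dilate_smul_monomial, norm_smul, norm_smul, norm_monomial, norm_monomial] at h1
  · rintro ⟨N, c, rfl, hc, hl⟩
    exact exists_isometric_solution_of_monomial fun k => (norm_lam_eq_iff hc).1 (hl k)

end Isometric

end PowerDilation

end

theorem theorem4p1 :
    -- isometric solutions, `t = 0`
    (∀ (f : PowerDilation.DirichletSpace 0) (lam : ℕ+ → ℂ), ‖f‖ = 1 →
      ((∃ T : PowerDilation.DirichletSpace 0 →L[ℂ] PowerDilation.DirichletSpace 0,
          PowerDilation.SolvesMoment f lam T ∧ Isometry T) ↔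
        PowerDilation.IsInner (PowerDilation.bohr f) ∧ ∀ k : ℕ+, ‖lam k‖ = 1)) ∧
    -- isometric solutions, `t ≠ 0`
    (∀ (t : ℝ) (f : PowerDilation.DirichletSpace t) (lam : ℕ+ → ℂ), t ≠ 0 → ‖f‖ = 1 →
      ((∃ T : PowerDilation.DirichletSpace t →L[ℂ] PowerDilation.DirichletSpace t,
          PowerDilation.SolvesMoment f lam T ∧ Isometry T) ↔
        ∃ (N : ℕ+) (c : ℂ), f = c • PowerDilation.DirichletSpace.monomial t N ∧
          ‖c‖ = ((N : ℝ) + 1) ^ (-(t / 2)) ∧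
          ∀ k : ℕ+, ‖lam k‖ =
            (((k : ℝ) * N + k + N + 1) / ((k : ℝ) * N + 1)) ^ (t / 2))) ∧
    -- surjective solutions, and invertible solutions
    (∀ (t : ℝ) (f : PowerDilation.DirichletSpace t) (lam : ℕ+ → ℂ), ‖f‖ = 1 →
      ((∃ T : PowerDilation.DirichletSpace t →L[ℂ] PowerDilation.DirichletSpace t,
          PowerDilation.SolvesMoment f lam T ∧ Function.Surjective T) ↔
        PowerDilation.IsInvertibleHInf (PowerDilation.bohrT f) ∧
          PowerDilation.BddAboveBelow lam) ∧
      ((∃ T : PowerDilation.DirichletSpace t →L[ℂ] PowerDilation.DirichletSpace t,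
          PowerDilation.SolvesMoment f lam T ∧ IsUnit T) ↔
        PowerDilation.IsInvertibleHInf (PowerDilation.bohrT f) ∧
          PowerDilation.BddAboveBelow lam)) ∧
    -- bounded solutions
    (∀ (t : ℝ) (f : PowerDilation.DirichletSpace t) (lam : ℕ+ → ℂ), ‖f‖ = 1 →
      PowerDilation.BddAboveBelow lam →
      ((∃ T : PowerDilation.DirichletSpace t →L[ℂ] PowerDilation.DirichletSpace t,
          PowerDilation.SolvesMoment f lam T) ↔
        PowerDilation.IsBdd (PowerDilation.bohrT f))) := by
  refine ⟨fun f lam hf => PowerDilation.exists_isometric_solution_zero_iff hf,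
    fun t f lam ht hf => PowerDilation.exists_isometric_solution_iff ht hf,
    fun t f lam hf => ?_, fun t f lam _ hlam => PowerDilation.exists_solution_iff hlam⟩
  have hf0 := PowerDilation.ne_zero_of_norm_eq_one hf
  exact ⟨PowerDilation.exists_surjective_solution_iff hf0,
    PowerDilation.exists_isUnit_solution_iff hf0⟩
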